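/- **Theorem 2.6.** Let $A$ and $B$ be rings (associative with unit, not necessarily commutative) and let $\Sigma$ be a $(B,A)$-bimodule that is finitely generated and projective as a right $A$-module. Put $\Sigma^*=\mathrm{Hom}_A(\Sigma,A)$, an $(A,B)$-bimodule via $(afb)(u)=a f(bu)$, and let $e=\sum_i e_i\otimes_A f_i\in\Sigma\otimes_A\Sigma^*$ be the dual basis element, i.e. $u=\sum_i e_if_i(u)$ for all $u\in\Sigma$. Let $\mathcal D=\Sigma^*\otimes_B\Sigma$ be the comatrix coring, the $A$-coring with comultiplication $\Delta(f\otimes_B u)=\sum_i (f\otimes_B e_i)\otimes_A (f_i\otimes_B u)$ and counit $\varepsilon(f\otimes_B u)=f(u)$. Then $\Sigma$ is a right $\mathcal D$-comodule via $u\mapsto \sum_i e_i\otimes_A(f_i\otimes_B u)$ and $\Sigma^*$ is a left $\mathcal D$-comodule via $f\mapsto\sum_i (f\otimes_B e_i)\otimes_A f_i$. Consider the two adjoint pairs $$K=-\otimes_B\Sigma:\ \mathcal M_B\to\mathcal M^{\mathcal D},\qquad R=\mathrm{Hom}^{\mathcal D}(\Sigma,-):\ \mathcal M^{\mathcal D}\to\mathcal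 M_B,$$ $$K'=\Sigma^*\otimes_B-:\ {}_B\mathcal M\to{}^{\mathcal D}\mathcal M,\qquad R'={}^{\mathcal D}\mathrm{Hom}(\Sigma^*,-):\ {}^{\mathcal D}\mathcal M\to{}_B\mathcal M,$$ between right (left) $B$-modules and right (left) $\mathcal D$-comodules, where $K(N)$ has coaction $n\otimes_B u\mapsto\sum_i(n\otimes_B e_i)\otimes_A(f_i\otimes_B u)$ and $K'(N)$ has coaction $f\otimes_B n\mapsto\sum_i(f\otimes_B e_i)\otimes_A(f_i\otimes_B n)$; the units are $n\mapsto(u\mapsto n\otimes_B u)$ and $n\mapsto(f\mapsto f\otimes_B n)$, and the counits are evaluation. A morphism of left $B$-modules is called pure if it stays injective after applying $N\otimes_B-$ for every right $B$-module $N$. A left $B$-module $P$ is called totally faithful if for every right $B$-module $N$ and every $n\in N$, $n\otimes_B p=0$ for all $p\in P$ implies $n=0$. Both notions are defined symmetrically for right $B$-modules. Suppose that every right $A$-linear map $\varphi:\Sigma\to\Sigma$ is also left $B$-linear. Then the following assertions are equivalent: 1. $(K,R)$ is a pair of inverse equivalences (the unit and the counit are isomorphisms); 2. $(K',R')$ is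 a pair of inverse equivalences; 3. $K$ is fully faithful; 4. $K'$ is fully faithful; 5. $l:B\to\Sigma\otimes_A\Sigma^*$, $l(b)=be=eb$, is pure as a morphism of left $B$-modules; 6. $\Sigma$ is totally faithful as a left $B$-module; 7. $l:B\to\Sigma\otimes_A\Sigma^*$, $l(b)=be=eb$, is pure as a morphism of right $B$-modules; 8. $\Sigma^*$ is totally faithful as a right $B$-module. -/

import Mathlib

open CategoryTheory MulOpposite

universe u

noncomputable section

namespace Comatrix

/-! ## Tensor products over noncommutative rings

A right `R`-module is a module over `Rᵐᵒᵖ`; `op r • m` is `m r`. -/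

section BTensor

open scoped TensorProduct

/-- The relations `m r ⊗ n = m ⊗ r n`, as a subgroup of `M ⊗[ℤ] N`. -/
def balancedRel (R : Type*) [Ring R] (M N : Type*) [AddCommGroup M] [Module Rᵐᵒᵖ M]
    [AddCommGroup N] [Module R N] : Submodule ℤ (M ⊗[ℤ] N) :=
  Submodule.span ℤ {x | ∃ (m : M) (r : R) (n : N), x = (op r • m) ⊗ₜ[ℤ] n - m ⊗ₜ[ℤ] (r • n)}

/-- The tensor product over `R` of a right `R`-module `M` and a left `R`-module `N`. -/
def BTensor (R : Type*) [Ring R] (M N : Type*) [AddCommGroup M] [Module Rᵐᵒᵖ M]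
    [AddCommGroup N] [Module R N] : Type _ :=
  (M ⊗[ℤ] N) ⧸ balancedRel R M N

namespace BTensor

variable {R : Type*} [Ring R] {M N M' N' : Type*}
  [AddCommGroup M] [Module Rᵐᵒᵖ M] [AddCommGroup N] [Module R N]
  [AddCommGroup M'] [Module Rᵐᵒᵖ M'] [AddCommGroup N'] [Module R N']

instance : AddCommGroup (BTensor R M N) :=
  inferInstanceAs (AddCommGroup ((M ⊗[ℤ] N) ⧸ balancedRel R M N))

variable (R) in
/-- The pure tensor `m ⊗ n`. -/
def tmul (m : M) (n : N) : BTensor R M N := Submodule.Quotient.mk (m ⊗ₜ[ℤ] n)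

theorem add_tmul (m m' : M) (n : N) : tmul R (m + m') n = tmul R m n + tmul R m' n := by
  unfold tmul; rw [TensorProduct.add_tmul]; rfl

theorem tmul_add (m : M) (n n' : N) : tmul R m (n + n') = tmul R m n + tmul R m n' := by
  unfold tmul; rw [TensorProduct.tmul_add]; rfl

theorem smul_tmul (m : M) (r : R) (n : N) : tmul R (op r • m) n = tmul R m (r • n) :=
  (Submodule.Quotient.eq _).2 (Submodule.subset_span ⟨m, r, n, rfl⟩)

theorem zero_tmul (n : N) : tmul R (0 : M) n = 0 :=
  map_zero (AddMonoidHom.mk' (fun m => tmul R m n) (fun m m' => add_tmul m m' n))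

theorem tmul_zero (m : M) : tmul R m (0 : N) = 0 :=
  map_zero (AddMonoidHom.mk' (tmul R m) (tmul_add m))

theorem neg_tmul (m : M) (n : N) : tmul R (-m) n = -tmul R m n :=
  map_neg (AddMonoidHom.mk' (fun m => tmul R m n) (fun m m' => add_tmul m m' n)) m

theorem tmul_neg (m : M) (n : N) : tmul R m (-n) = -tmul R m n :=
  map_neg (AddMonoidHom.mk' (tmul R m) (tmul_add m)) n

theorem tmul_sum {ι : Type*} (s : Finset ι) (m : M) (n : ι → N) :
    tmul R m (∑ i ∈ s, n i) = ∑ i ∈ s, tmul R m (n i) :=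
  map_sum (AddMonoidHom.mk' (tmul R m) (tmul_add m)) n s

theorem sum_tmul {ι : Type*} (s : Finset ι) (m : ι → M) (n : N) :
    tmul R (∑ i ∈ s, m i) n = ∑ i ∈ s, tmul R (m i) n :=
  map_sum (AddMonoidHom.mk' (fun m => tmul R m n) (fun m m' => add_tmul m m' n)) m s

@[elab_as_elim]
theorem induction_on {motive : BTensor R M N → Prop} (x : BTensor R M N)
    (zero : motive 0) (tmul : ∀ m n, motive (tmul R m n))
    (add : ∀ x y, motive x → motive y → motive (x + y)) : motive x := by
  obtain ⟨y, rfl⟩ := Submodule.Quotient.mk_surjective _ x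
  induction y with
  | zero => exact zero
  | tmul m n => exact tmul m n
  | add a b ha hb => exact add _ _ ha hb

theorem hom_ext {P : Type*} [AddCommGroup P] {f g : BTensor R M N →+ P}
    (h : ∀ m n, f (tmul R m n) = g (tmul R m n)) : f = g := by
  ext x
  induction x using induction_on with
  | zero => simp
  | tmul m n => exact h m n
  | add x y hx hy => simp [hx, hy]

/-- The universal property: biadditive balanced maps `M × N → P` are additive maps
`M ⊗ N → P`. -/
def lift {P : Type*} [AddCommGroup P] (f : M → N → P)
    (hl : ∀ m m' n, f (m + m') n = f m n + f m' n)
    (hr : ∀ m n n', f m (n + n') = f m n + f m n')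
    (hb : ∀ m (r : R) n, f (op r • m) n = f m (r • n)) : BTensor R M N →+ P :=
  (Submodule.liftQ (balancedRel R M N)
    ((TensorProduct.liftAddHom
      (AddMonoidHom.mk' (fun m => AddMonoidHom.mk' (f m) (hr m))
        (fun m m' => by ext n; exact hl m m' n))
      (fun r m n => (map_zsmul (AddMonoidHom.mk' (fun m => f m n) (fun m m' => hl m m' n)) r m).trans
        (map_zsmul (AddMonoidHom.mk' (f m) (hr m)) r n).symm)).toIntLinearMap)
    (by
      refine Submodule.span_le.2 ?_
      rintro _ ⟨m, r, n, rfl⟩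
      rw [SetLike.mem_coe, LinearMap.mem_ker, map_sub]
      exact sub_eq_zero.2 (hb m r n))).toAddMonoidHom

@[simp]
theorem lift_tmul {P : Type*} [AddCommGroup P] (f : M → N → P) (hl) (hr) (hb) (m : M) (n : N) :
    lift (R := R) f hl hr hb (tmul R m n) = f m n := rfl

/-- The map `f ⊗ g` for a right linear `f` and a left linear `g`. -/
def map (f : M →ₗ[Rᵐᵒᵖ] M') (g : N →ₗ[R] N') : BTensor R M N →+ BTensor R M' N' :=
  lift (fun m n => tmul R (f m) (g n))
    (fun m m' n => by rw [map_add, add_tmul])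
    (fun m n n' => by rw [map_add, tmul_add])
    (fun m r n => by rw [map_smul, map_smul, smul_tmul])

@[simp]
theorem map_tmul (f : M →ₗ[Rᵐᵒᵖ] M') (g : N →ₗ[R] N') (m : M) (n : N) :
    map f g (tmul R m n) = tmul R (f m) (g n) := rfl

theorem map_id (x : BTensor R M N) :
    map (LinearMap.id : M →ₗ[Rᵐᵒᵖ] M) (LinearMap.id : N →ₗ[R] N) x = x :=
  DFunLike.congr_fun (hom_ext (f := map LinearMap.id LinearMap.id) (g := AddMonoidHom.id _)
    fun _ _ => rfl) x

/-- If `M` is an `(L, R)`-bimodule, then `M ⊗ N` is a left `L`-module: `l (m ⊗ n) = l m ⊗ n`. -/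
instance leftModule {L : Type*} [Ring L] [Module L M] [SMulCommClass L Rᵐᵒᵖ M] :
    Module L (BTensor R M N) where
  smul l x := map (DistribSMul.toLinearMap Rᵐᵒᵖ M l) LinearMap.id x
  one_smul x := DFunLike.congr_fun (hom_ext
    (f := map (DistribSMul.toLinearMap Rᵐᵒᵖ M (1 : L)) LinearMap.id)
    (g := AddMonoidHom.id (BTensor R M N)) fun m n => by simp) x
  mul_smul l l' x := DFunLike.congr_fun (hom_ext
    (f := map (DistribSMul.toLinearMap Rᵐᵒᵖ M (l * l')) (LinearMap.id (M := N)))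
    (g := (map (DistribSMul.toLinearMap Rᵐᵒᵖ M l) LinearMap.id).comp
      (map (DistribSMul.toLinearMap Rᵐᵒᵖ M l') LinearMap.id))
    fun m n => by simp [mul_smul]) x
  smul_zero l := map_zero (map _ _)
  smul_add l := map_add (map _ _)
  add_smul l l' x := DFunLike.congr_fun (hom_ext
    (f := map (DistribSMul.toLinearMap Rᵐᵒᵖ M (l + l')) (LinearMap.id (M := N)))
    (g := map (DistribSMul.toLinearMap Rᵐᵒᵖ M l) LinearMap.id +
      map (DistribSMul.toLinearMap Rᵐᵒᵖ M l') LinearMap.id)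
    fun m n => by simp [add_smul, add_tmul]) x
  zero_smul x := DFunLike.congr_fun (hom_ext
    (f := map (DistribSMul.toLinearMap Rᵐᵒᵖ M (0 : L)) (LinearMap.id (M := N)))
    (g := 0) fun m n => by simp [zero_tmul]) x

/-- If `N` is an `(R, T)`-bimodule, then `M ⊗ N` is a right `T`-module: `(m ⊗ n) t = m ⊗ n t`. -/
instance rightModule {T : Type*} [Ring T] [Module Tᵐᵒᵖ N] [SMulCommClass R Tᵐᵒᵖ N] :
    Module Tᵐᵒᵖ (BTensor R M N) :=
  haveI := SMulCommClass.symm R Tᵐᵒᵖ N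
  { smul := fun t x => map LinearMap.id (DistribSMul.toLinearMap R N t) x
    one_smul := fun x => DFunLike.congr_fun (hom_ext
      (f := map LinearMap.id (DistribSMul.toLinearMap R N (1 : Tᵐᵒᵖ)))
      (g := AddMonoidHom.id (BTensor R M N)) fun m n => by simp) x
    mul_smul := fun t t' x => DFunLike.congr_fun (hom_ext
      (f := map (LinearMap.id (M := M)) (DistribSMul.toLinearMap R N (t * t')))
      (g := (map LinearMap.id (DistribSMul.toLinearMap R N t)).comp
        (map LinearMap.id (DistribSMul.toLinearMap R N t')))
      fun m n => by simp [mul_smul]) x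
    smul_zero := fun t => map_zero (map _ _)
    smul_add := fun t => map_add (map _ _)
    add_smul := fun t t' x => DFunLike.congr_fun (hom_ext
      (f := map (LinearMap.id (M := M)) (DistribSMul.toLinearMap R N (t + t')))
      (g := map LinearMap.id (DistribSMul.toLinearMap R N t) +
        map LinearMap.id (DistribSMul.toLinearMap R N t'))
      fun m n => by simp [add_smul, tmul_add]) x
    zero_smul := fun x => DFunLike.congr_fun (hom_ext
      (f := map (LinearMap.id (M := M)) (DistribSMul.toLinearMap R N (0 : Tᵐᵒᵖ)))
      (g := 0) fun m n => by simp [tmul_zero]) x }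

theorem left_smul_tmul {L : Type*} [Ring L] [Module L M] [SMulCommClass L Rᵐᵒᵖ M]
    (l : L) (m : M) (n : N) : l • tmul R m n = tmul R (l • m) n := rfl

theorem right_smul_tmul {T : Type*} [Ring T] [Module Tᵐᵒᵖ N] [SMulCommClass R Tᵐᵒᵖ N]
    (t : Tᵐᵒᵖ) (m : M) (n : N) : t • tmul R m n = tmul R m (t • n) := rfl

instance bimodule {L T : Type*} [Ring L] [Module L M] [SMulCommClass L Rᵐᵒᵖ M]
    [Ring T] [Module Tᵐᵒᵖ N] [SMulCommClass R Tᵐᵒᵖ N] :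
    SMulCommClass L Tᵐᵒᵖ (BTensor R M N) where
  smul_comm l t x := by
    induction x using induction_on with
    | zero => simp
    | tmul m n => simp only [left_smul_tmul, right_smul_tmul]
    | add x y hx hy => simp only [smul_add, hx, hy]

variable (R N) in
/-- The right linear map `n ↦ m ⊗ n`. -/
def mkRight (T : Type*) [Ring T] [Module Tᵐᵒᵖ N] [SMulCommClass R Tᵐᵒᵖ N] (m : M) :
    N →ₗ[Tᵐᵒᵖ] BTensor R M N where
  toFun := tmul R m
  map_add' := tmul_add m
  map_smul' _ _ := rfl

variable (R M) in
/-- The left linear map `m ↦ m ⊗ n`. -/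
def mkLeft (L : Type*) [Ring L] [Module L M] [SMulCommClass L Rᵐᵒᵖ M] (n : N) :
    M →ₗ[L] BTensor R M N where
  toFun m := tmul R m n
  map_add' m m' := add_tmul m m' n
  map_smul' _ _ := rfl

theorem mkRight_apply {T : Type*} [Ring T] [Module Tᵐᵒᵖ N] [SMulCommClass R Tᵐᵒᵖ N] (m : M)
    (n : N) : mkRight R N T m n = tmul R m n := rfl

theorem mkLeft_apply {L : Type*} [Ring L] [Module L M] [SMulCommClass L Rᵐᵒᵖ M] (m : M)
    (n : N) : mkLeft R M L n m = tmul R m n := rfl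

/-- The canonical map `(M ⊗ N) ⊗ P → M ⊗ (N ⊗ P)`. -/
def assoc {R T : Type*} [Ring R] [Ring T] {M N P : Type*} [AddCommGroup M] [Module Rᵐᵒᵖ M]
    [AddCommGroup N] [Module R N] [Module Tᵐᵒᵖ N] [SMulCommClass R Tᵐᵒᵖ N]
    [AddCommGroup P] [Module T P] :
    BTensor T (BTensor R M N) P →+ BTensor R M (BTensor T N P) :=
  lift (fun x p => lift (R := R) (fun m n => tmul R m (tmul T n p))
      (fun m m' n => add_tmul _ _ _)
      (fun m n n' => by rw [add_tmul, tmul_add])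
      (fun m r n => by rw [smul_tmul, left_smul_tmul]) x)
    (fun x x' p => map_add _ _ _)
    (fun x p p' => by
      rw [← AddMonoidHom.add_apply]
      exact DFunLike.congr_fun (hom_ext fun m n => by simp [tmul_add]) x)
    (fun x t p => by
      induction x using induction_on with
      | zero => simp
      | tmul m n => simp only [right_smul_tmul, lift_tmul, smul_tmul]
      | add x y hx hy => simp only [smul_add, map_add, hx, hy])

@[simp]
theorem assoc_tmul {R T : Type*} [Ring R] [Ring T] {M N P : Type*} [AddCommGroup M]
    [Module Rᵐᵒᵖ M] [AddCommGroup N] [Module R N] [Module Tᵐᵒᵖ N] [SMulCommClass R Tᵐᵒᵖ N]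
    [AddCommGroup P] [Module T P] (m : M) (n : N) (p : P) :
    assoc (tmul T (tmul R m n) p) = tmul R m (tmul T n p) := rfl

variable (R N) in
/-- The canonical map `R ⊗ N → N`, `r ⊗ n ↦ r n`. -/
def lid : BTensor R R N →+ N :=
  lift (fun r n => r • n) (fun r r' n => add_smul r r' n) (fun r n n' => smul_add r n n')
    (fun m r n => by rw [op_smul_eq_mul, mul_smul])

variable (R M) in
/-- The canonical map `M ⊗ R → M`, `m ⊗ r ↦ m r`. -/
def rid : BTensor R M R →+ M :=
  lift (fun m r => op r • m) (fun m m' r => smul_add _ m m')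
    (fun m r r' => add_smul (op r) (op r') m)
    (fun m r r' => by rw [smul_eq_mul, op_mul, mul_smul])

@[simp] theorem lid_tmul (r : R) (n : N) : lid R N (tmul R r n) = r • n := rfl

@[simp] theorem rid_tmul (m : M) (r : R) : rid R M (tmul R m r) = op r • m := rfl

end BTensor

end BTensor

open BTensor

/-! ## Purity and total faithfulness -/

section Purity

variable {B : Type u} [Ring B]

/-- A morphism of left `B`-modules is pure if it stays injective after tensoring with any
right `B`-module. -/
def IsPureLeft {P Q : Type u} [AddCommGroup P] [Module B P] [AddCommGroup Q] [Module B Q]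
    (f : P →ₗ[B] Q) : Prop :=
  ∀ (N : Type u) [AddCommGroup N] [Module Bᵐᵒᵖ N],
    Function.Injective (map (LinearMap.id : N →ₗ[Bᵐᵒᵖ] N) f)

/-- A morphism of right `B`-modules is pure if it stays injective after tensoring with any
left `B`-module. -/
def IsPureRight {P Q : Type u} [AddCommGroup P] [Module Bᵐᵒᵖ P] [AddCommGroup Q]
    [Module Bᵐᵒᵖ Q] (f : P →ₗ[Bᵐᵒᵖ] Q) : Prop :=
  ∀ (N : Type u) [AddCommGroup N] [Module B N],
    Function.Injective (map f (LinearMap.id : N →ₗ[B] N))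

variable (B)

/-- A left `B`-module `P` is totally faithful if, for every right `B`-module `N` and `n ∈ N`,
`n ⊗ p = 0` for all `p ∈ P` implies `n = 0`. -/
def TotallyFaithfulLeft (P : Type u) [AddCommGroup P] [Module B P] : Prop :=
  ∀ (N : Type u) [AddCommGroup N] [Module Bᵐᵒᵖ N] (n : N),
    (∀ p : P, tmul B n p = 0) → n = 0

/-- A right `B`-module `P` is totally faithful if, for every left `B`-module `N` and `n ∈ N`,
`p ⊗ n = 0` for all `p ∈ P` implies `n = 0`. -/
def TotallyFaithfulRight (P : Type u) [AddCommGroup P] [Module Bᵐᵒᵖ P] : Prop :=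
  ∀ (N : Type u) [AddCommGroup N] [Module B N] (n : N),
    (∀ p : P, tmul B p n = 0) → n = 0

end Purity

/-! ## Corings and comodules -/

/-- A left linear map between bimodules that respects the right actions, as a right linear
map. -/
def toRightLinear {A M N : Type*} [Ring A] [AddCommGroup M] [Module A M] [Module Aᵐᵒᵖ M]
    [AddCommGroup N] [Module A N] [Module Aᵐᵒᵖ N] (f : M →ₗ[A] N)
    (hf : ∀ (a : Aᵐᵒᵖ) (m : M), f (a • m) = a • f m) : M →ₗ[Aᵐᵒᵖ] N where
  toFun := f
  map_add' := map_add f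
  map_smul' := hf

/-- An `A`-coring: an `A`-bimodule `C` with `A`-bimodule maps `Δ : C → C ⊗ C` (comultiplication)
and `ε : C → A` (counit) that are coassociative and counital. -/
structure Coring (A : Type u) [Ring A] where
  carrier : Type u
  [instAddCommGroup : AddCommGroup carrier]
  [instLeftModule : Module A carrier]
  [instRightModule : Module Aᵐᵒᵖ carrier]
  [instSMulCommClass : SMulCommClass A Aᵐᵒᵖ carrier]
  comul : carrier →ₗ[A] BTensor A carrier carrier
  comul_op_smul : ∀ (a : Aᵐᵒᵖ) (c : carrier), comul (a • c) = a • comul c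
  counit : carrier →ₗ[A] A
  counit_op_smul : ∀ (a : Aᵐᵒᵖ) (c : carrier), counit (a • c) = a • counit c
  coassoc : ∀ c,
    assoc (map (toRightLinear comul comul_op_smul) LinearMap.id (comul c)) =
      map LinearMap.id comul (comul c)
  counit_comul : ∀ c,
    lid A carrier (map (toRightLinear counit counit_op_smul) LinearMap.id (comul c)) = c
  comul_counit : ∀ c, rid A carrier (map LinearMap.id counit (comul c)) = c

attribute [instance] Coring.instAddCommGroup Coring.instLeftModule Coring.instRightModule
  Coring.instSMulCommClass

namespace Coring

variable {A : Type u} [Ring A] (C : Coring A)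

/-- The comultiplication, as a right linear map. -/
def comulRight : C.carrier →ₗ[Aᵐᵒᵖ] BTensor A C.carrier C.carrier :=
  toRightLinear C.comul C.comul_op_smul

/-- The counit, as a right linear map. -/
def counitRight : C.carrier →ₗ[Aᵐᵒᵖ] A := toRightLinear C.counit C.counit_op_smul

end Coring

/-- Right comodules over a coring. -/
structure RightComodule {A : Type u} [Ring A] (C : Coring A) where
  carrier : Type u
  [instAddCommGroup : AddCommGroup carrier]
  [instModule : Module Aᵐᵒᵖ carrier]
  /-- The coaction `ρ : M → M ⊗ C`. -/
  coact : carrier →ₗ[Aᵐᵒᵖ] BTensor A carrier C.carrier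
  coassoc : ∀ m, assoc (map coact LinearMap.id (coact m)) = map LinearMap.id C.comul (coact m)
  counit : ∀ m, rid A carrier (map LinearMap.id C.counit (coact m)) = m

/-- Left comodules over a coring. -/
structure LeftComodule {A : Type u} [Ring A] (C : Coring A) where
  carrier : Type u
  [instAddCommGroup : AddCommGroup carrier]
  [instModule : Module A carrier]
  /-- The coaction `ρ : M → C ⊗ M`. -/
  coact : carrier →ₗ[A] BTensor A C.carrier carrier
  coassoc : ∀ m,
    assoc (map C.comulRight LinearMap.id (coact m)) =
      map LinearMap.id coact (coact m)
  counit : ∀ m,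
    lid A carrier (map C.counitRight LinearMap.id (coact m)) = m

attribute [instance] RightComodule.instAddCommGroup RightComodule.instModule
  LeftComodule.instAddCommGroup LeftComodule.instModule

section Categories

variable {A : Type u} [Ring A] {C : Coring A}

/-- The group of right colinear maps, `ρ (f m) = (f ⊗ C) (ρ m)`. -/
def RightComodule.colinear (M N : RightComodule C) :
    AddSubgroup (M.carrier →ₗ[Aᵐᵒᵖ] N.carrier) where
  carrier := {f | ∀ m, N.coact (f m) = map f LinearMap.id (M.coact m)}
  add_mem' {f g} hf hg m := by
    rw [LinearMap.add_apply, map_add, hf m, hg m, ← AddMonoidHom.add_apply]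
    exact DFunLike.congr_fun (hom_ext fun m n => by simp [add_tmul]) _
  zero_mem' m := by
    rw [LinearMap.zero_apply, map_zero]
    exact (DFunLike.congr_fun (hom_ext (g := 0) fun m n => by simp [zero_tmul]) _).symm
  neg_mem' {f} hf m := by
    rw [LinearMap.neg_apply, map_neg, hf m, ← AddMonoidHom.neg_apply]
    exact DFunLike.congr_fun (hom_ext fun m n => by simp [neg_tmul]) _

/-- The group of left colinear maps, `ρ (f m) = (C ⊗ f) (ρ m)`. -/
def LeftComodule.colinear (M N : LeftComodule C) :
    AddSubgroup (M.carrier →ₗ[A] N.carrier) where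
  carrier := {f | ∀ m, N.coact (f m) = map LinearMap.id f (M.coact m)}
  add_mem' {f g} hf hg m := by
    rw [LinearMap.add_apply, map_add, hf m, hg m, ← AddMonoidHom.add_apply]
    exact DFunLike.congr_fun (hom_ext fun m n => by simp [tmul_add]) _
  zero_mem' m := by
    rw [LinearMap.zero_apply, map_zero]
    exact (DFunLike.congr_fun (hom_ext (g := 0) fun m n => by simp [tmul_zero]) _).symm
  neg_mem' {f} hf m := by
    rw [LinearMap.neg_apply, map_neg, hf m, ← AddMonoidHom.neg_apply]
    exact DFunLike.congr_fun (hom_ext fun m n => by simp [tmul_neg]) _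

/-- The category of right comodules and right colinear maps. -/
instance : Category.{u} (RightComodule C) where
  Hom M N := RightComodule.colinear M N
  id M := ⟨LinearMap.id, fun m => (map_id _).symm⟩
  comp {M N P} f g := ⟨g.1.comp f.1, fun m => by
    rw [LinearMap.comp_apply, g.2, f.2, ← AddMonoidHom.comp_apply]
    exact DFunLike.congr_fun (hom_ext fun m n => by simp) _⟩

/-- The category of left comodules and left colinear maps. -/
instance : Category.{u} (LeftComodule C) where
  Hom M N := LeftComodule.colinear M N
  id M := ⟨LinearMap.id, fun m => (map_id _).symm⟩
  comp {M N P} f g := ⟨g.1.comp f.1, fun m => by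
    rw [LinearMap.comp_apply, g.2, f.2, ← AddMonoidHom.comp_apply]
    exact DFunLike.congr_fun (hom_ext fun m n => by simp) _⟩

end Categories

/-! ## Dual modules and dual bases -/

/-- The dual `S* = Hom_A(S, A)` of a right `A`-module. -/
def RDual (A S : Type u) [Ring A] [AddCommGroup S] [Module Aᵐᵒᵖ S] : Type u := S →ₗ[Aᵐᵒᵖ] A

namespace RDual

variable {A B S : Type u} [Ring A] [Ring B] [AddCommGroup S] [Module B S] [Module Aᵐᵒᵖ S]
  [SMulCommClass B Aᵐᵒᵖ S]

instance : AddCommGroup (RDual A S) := inferInstanceAs (AddCommGroup (S →ₗ[Aᵐᵒᵖ] A))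

instance : FunLike (RDual A S) S A := inferInstanceAs (FunLike (S →ₗ[Aᵐᵒᵖ] A) S A)

instance : LinearMapClass (RDual A S) Aᵐᵒᵖ S A :=
  inferInstanceAs (LinearMapClass (S →ₗ[Aᵐᵒᵖ] A) Aᵐᵒᵖ S A)

/-- `(a f) u = a (f u)` -/
instance : Module A (RDual A S) := inferInstanceAs (Module A (S →ₗ[Aᵐᵒᵖ] A))

@[ext] theorem ext {f g : RDual A S} (h : ∀ u, f u = g u) : f = g := LinearMap.ext h

@[simp] theorem add_apply (f g : RDual A S) (u : S) : (f + g) u = f u + g u := rfl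

@[simp] theorem zero_apply (u : S) : (0 : RDual A S) u = 0 := rfl

@[simp] theorem smul_apply (a : A) (f : RDual A S) (u : S) : (a • f) u = a * f u := rfl

/-- `(f b) u = f (b u)` -/
instance : Module Bᵐᵒᵖ (RDual A S) where
  smul b f := LinearMap.comp (show S →ₗ[Aᵐᵒᵖ] A from f) (DistribSMul.toLinearMap Aᵐᵒᵖ S b.unop)
  one_smul f := ext fun u => congrArg f (one_smul B u)
  mul_smul b b' f := ext fun u => congrArg f (mul_smul b'.unop b.unop u)
  smul_zero _ := rfl
  smul_add _ _ _ := rfl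
  add_smul b b' f := ext fun u => (congrArg f (add_smul b.unop b'.unop u)).trans (map_add f _ _)
  zero_smul f := ext fun u => (congrArg f (zero_smul B u)).trans (map_zero f)

@[simp] theorem op_smul_apply (b : B) (f : RDual A S) (u : S) : (op b • f) u = f (b • u) := rfl

instance : SMulCommClass A Bᵐᵒᵖ (RDual A S) where
  smul_comm _ _ _ := rfl

end RDual

/-- A finite dual basis `e₁, …, eₙ ∈ S`, `f₁, …, fₙ ∈ S*` of the right `A`-module `S`:
`u = ∑ eᵢ fᵢ(u)` for all `u`. -/
structure FiniteDualBasis (A S : Type u) [Ring A] [AddCommGroup S] [Module Aᵐᵒᵖ S] where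
  n : ℕ
  vec : Fin n → S
  covec : Fin n → RDual A S
  sum_eq : ∀ u : S, ∑ i, op (covec i u) • vec i = u

theorem nonempty_finiteDualBasis (A S : Type u) [Ring A] [AddCommGroup S] [Module Aᵐᵒᵖ S]
    [Module.Finite Aᵐᵒᵖ S] [Module.Projective Aᵐᵒᵖ S] : Nonempty (FiniteDualBasis A S) := by
  obtain ⟨n, p, s, hp⟩ := Module.Finite.exists_comp_eq_id_of_projective Aᵐᵒᵖ S
  obtain ⟨-, -, hs⟩ := hp
  let c : Fin n → RDual A S := fun i =>
    ({ toFun := fun u => (s u i).unop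
       map_add' := fun x y => by simp
       map_smul' := fun a x => by simp } : S →ₗ[Aᵐᵒᵖ] A)
  refine ⟨⟨n, fun i => p (Pi.single i 1), c, fun u => ?_⟩⟩
  have h : p (s u) = u := LinearMap.congr_fun hs u
  conv_rhs => rw [← h, LinearMap.pi_apply_eq_sum_univ p (s u)]
  refine Finset.sum_congr rfl fun i _ => ?_
  congr 2
  ext j
  simp [Pi.single_apply, eq_comm]

/-! ## The comatrix coring -/

namespace FiniteDualBasis

variable {A B S : Type u} [Ring A] [Ring B] [AddCommGroup S] [Module B S] [Module Aᵐᵒᵖ S]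
  [SMulCommClass B Aᵐᵒᵖ S] (e : FiniteDualBasis A S)

/-- The element `e = ∑ eᵢ ⊗ fᵢ` of `S ⊗_A S*`. -/
def elt : BTensor A S (RDual A S) := ∑ i, tmul A (e.vec i) (e.covec i)

theorem sum_smul (f : RDual A S) : ∑ i, f (e.vec i) • e.covec i = f := by
  ext u
  conv_rhs => rw [← e.sum_eq u, map_sum]
  have h : ∀ (s : Finset (Fin e.n)) (g : Fin e.n → RDual A S),
      (∑ i ∈ s, g i) u = ∑ i ∈ s, g i u := fun s g =>
    map_sum (AddMonoidHom.mk' (fun f : RDual A S => f u) fun _ _ => rfl) g s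
  rw [h]
  exact Finset.sum_congr rfl fun i _ => (map_smul f (op (e.covec i u)) (e.vec i)).symm

/-- `b e = e b` -/
theorem smul_elt (b : B) : b • e.elt = op b • e.elt := by
  have h1 : ∀ i, tmul A (b • e.vec i) (e.covec i) =
      ∑ j, tmul A (e.vec j) (e.covec j (b • e.vec i) • e.covec i) := fun i => by
    conv_lhs => rw [← e.sum_eq (b • e.vec i), sum_tmul]
    exact Finset.sum_congr rfl fun j _ => smul_tmul _ _ _
  have h2 : ∀ j, op b • e.covec j = ∑ i, e.covec j (b • e.vec i) • e.covec i := fun j =>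
    (e.sum_smul (op b • e.covec j)).symm
  simp only [elt, Finset.smul_sum, left_smul_tmul, right_smul_tmul, h1, h2, tmul_sum]
  exact Finset.sum_comm

/-- The map `l : B → S ⊗_A S*`, `l b = b e = e b`, as a map of left `B`-modules. -/
def lLeft : B →ₗ[B] BTensor A S (RDual A S) where
  toFun b := b • e.elt
  map_add' b b' := add_smul b b' _
  map_smul' b b' := mul_smul b b' _

/-- The map `l : B → S ⊗_A S*`, `l b = b e = e b`, as a map of right `B`-modules. -/
def lRight : B →ₗ[Bᵐᵒᵖ] BTensor A S (RDual A S) where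
  toFun b := b • e.elt
  map_add' b b' := add_smul b b' _
  map_smul' b b' := by
    rw [smul_elt, smul_elt]
    exact mul_smul b (op b') _

section Sandwich

variable (M N : Type u) [AddCommGroup M] [Module Bᵐᵒᵖ M] [AddCommGroup N] [Module B N]
variable {M N}

variable (A B S) in
/-- `x ⊗ g ↦ (m ⊗ x) ⊗ (g ⊗ n)` -/
def sandwich (m : M) (n : N) : BTensor A S (RDual A S) →+
    BTensor A (BTensor B M S) (BTensor B (RDual A S) N) :=
  lift (fun x g => tmul A (tmul B m x) (tmul B g n))
    (fun x x' g => by rw [tmul_add, add_tmul])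
    (fun x g g' => by rw [add_tmul, tmul_add])
    (fun x a g => by rw [← right_smul_tmul, smul_tmul, left_smul_tmul])

theorem sandwich_elt (m : M) (n : N) : sandwich A B S m n e.elt =
    ∑ i, tmul A (tmul B m (e.vec i)) (tmul B (e.covec i) n) := by
  rw [elt, map_sum]; rfl

theorem sandwich_op_smul (m : M) (b : B) (n : N) (x : BTensor A S (RDual A S)) :
    sandwich A B S (op b • m) n x = sandwich A B S m n (b • x) := by
  induction x using induction_on with
  | zero => simp
  | tmul x g => simp [sandwich, left_smul_tmul, smul_tmul]
  | add x y hx hy => simp only [smul_add, map_add, hx, hy]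

theorem sandwich_smul (m : M) (b : B) (n : N) (x : BTensor A S (RDual A S)) :
    sandwich A B S m (b • n) x = sandwich A B S m n (op b • x) := by
  induction x using induction_on with
  | zero => simp
  | tmul x g => simp [sandwich, right_smul_tmul, smul_tmul]
  | add x y hx hy => simp only [smul_add, map_add, hx, hy]

variable (M N) in
/-- The map `M ⊗_B N → (M ⊗_B S) ⊗_A (S* ⊗_B N)`, `m ⊗ n ↦ m ⊗ e ⊗ n`. -/
def insert : BTensor B M N →+ BTensor A (BTensor B M S) (BTensor B (RDual A S) N) :=
  lift (fun m n => sandwich A B S m n e.elt)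
    (fun m m' n => by simp only [sandwich_elt, add_tmul, Finset.sum_add_distrib])
    (fun m n n' => by simp only [sandwich_elt, tmul_add, Finset.sum_add_distrib])
    (fun m b n => by rw [sandwich_op_smul, sandwich_smul, smul_elt])

theorem insert_tmul (m : M) (n : N) : e.insert M N (tmul B m n) =
    ∑ i, tmul A (tmul B m (e.vec i)) (tmul B (e.covec i) n) := e.sandwich_elt m n

theorem insert_smul {L : Type u} [Ring L] [Module L M] [SMulCommClass L Bᵐᵒᵖ M] (a : L)
    (x : BTensor B M N) : e.insert M N (a • x) = a • e.insert M N x := by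
  induction x using induction_on with
  | zero => simp
  | tmul m n => simp only [left_smul_tmul, insert_tmul, Finset.smul_sum]
  | add x y hx hy => simp only [smul_add, map_add, hx, hy]

theorem insert_op_smul {L : Type u} [Ring L] [Module Lᵐᵒᵖ N] [SMulCommClass B Lᵐᵒᵖ N]
    (a : Lᵐᵒᵖ) (x : BTensor B M N) : e.insert M N (a • x) = a • e.insert M N x := by
  induction x using induction_on with
  | zero => simp
  | tmul m n => simp only [right_smul_tmul, insert_tmul, Finset.smul_sum]
  | add x y hx hy => simp only [smul_add, map_add, hx, hy]

variable (A B S M) in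
/-- The coaction of `M ⊗_B S`, as a right linear map. -/
def insertRight : BTensor B M S →ₗ[Aᵐᵒᵖ]
    BTensor A (BTensor B M S) (BTensor B (RDual A S) S) where
  toFun := e.insert M S
  map_add' := map_add _
  map_smul' := e.insert_op_smul

variable (A B S N) in
/-- The coaction of `S* ⊗_B N`, as a left linear map. -/
def insertLeft : BTensor B (RDual A S) N →ₗ[A]
    BTensor A (BTensor B (RDual A S) S) (BTensor B (RDual A S) N) where
  toFun := e.insert (RDual A S) N
  map_add' := map_add _
  map_smul' := e.insert_smul

theorem insert_coassoc (x : BTensor B M N) :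
    assoc (map (e.insertRight A B S M) LinearMap.id (e.insert M N x)) =
      map LinearMap.id (e.insertLeft A B S N) (e.insert M N x) := by
  induction x using induction_on with
  | zero => simp
  | tmul m n =>
    simp only [insert_tmul, map_sum, map_tmul, LinearMap.id_apply, insertRight, insertLeft,
      LinearMap.coe_mk, AddHom.coe_mk, sum_tmul, tmul_sum, assoc_tmul]
    exact Finset.sum_comm
  | add x y hx hy => simp only [map_add, hx, hy]

end Sandwich

variable (A B S) in
/-- The counit `S* ⊗_B S → A`, `f ⊗ u ↦ f u`, of the comatrix coring. -/
def eval : BTensor B (RDual A S) S →ₗ[A] A where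
  toFun := lift (fun (f : RDual A S) (u : S) => f u) (fun _ _ _ => rfl) (fun f => map_add f)
    (fun _ _ _ => rfl)
  map_add' := map_add _
  map_smul' a x := by
    induction x using induction_on with
    | zero => simp
    | tmul f u => rfl
    | add x y hx hy => simp only [smul_add, map_add, hx, hy]

@[simp] theorem eval_tmul (f : RDual A S) (u : S) : eval A B S (tmul B f u) = f u := rfl

theorem eval_op_smul (a : Aᵐᵒᵖ) (x : BTensor B (RDual A S) S) :
    eval A B S (a • x) = a • eval A B S x := by
  induction x using induction_on with
  | zero => simp
  | tmul f u => exact map_smul f a u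
  | add x y hx hy => simp only [smul_add, map_add, hx, hy]

theorem insert_eval {M : Type u} [AddCommGroup M] [Module Bᵐᵒᵖ M] (x : BTensor B M S) :
    rid A _ (map LinearMap.id (eval A B S) (e.insert M S x)) = x := by
  induction x using induction_on with
  | zero => simp
  | tmul m u =>
    simp only [insert_tmul, map_sum, map_tmul, LinearMap.id_apply, eval_tmul, rid_tmul,
      right_smul_tmul]
    rw [← tmul_sum, e.sum_eq]
  | add x y hx hy => simp only [map_add, hx, hy]

theorem eval_insert {N : Type u} [AddCommGroup N] [Module B N] (x : BTensor B (RDual A S) N) :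
    lid A _ (map (toRightLinear (eval A B S) eval_op_smul) LinearMap.id
      (e.insert (RDual A S) N x)) = x := by
  induction x using induction_on with
  | zero => simp
  | tmul f n =>
    simp only [insert_tmul, map_sum, map_tmul, LinearMap.id_apply, toRightLinear,
      LinearMap.coe_mk, AddHom.coe_mk, eval_tmul, lid_tmul, left_smul_tmul]
    rw [← sum_tmul, e.sum_smul]
  | add x y hx hy => simp only [map_add, hx, hy]

variable (B) in
/-- The right coaction `u ↦ e ⊗ u` on `S`. -/
def coactVec : S →ₗ[Aᵐᵒᵖ] BTensor A S (BTensor B (RDual A S) S) where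
  toFun u := ∑ i, tmul A (e.vec i) (tmul B (e.covec i) u)
  map_add' u v := by simp only [tmul_add, Finset.sum_add_distrib]
  map_smul' a u := by simp only [RingHom.id_apply, Finset.smul_sum, right_smul_tmul]

theorem coactVec_apply (u : S) :
    e.coactVec B u = ∑ i, tmul A (e.vec i) (tmul B (e.covec i) u) := rfl

theorem coactVec_coassoc (u : S) :
    assoc (map (e.coactVec B) LinearMap.id (e.coactVec B u)) =
      map LinearMap.id (e.insertLeft A B S S) (e.coactVec B u) := by
  simp only [coactVec_apply, insertLeft, LinearMap.coe_mk, AddHom.coe_mk, insert_tmul, map_sum,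
    map_tmul, LinearMap.id_apply, sum_tmul, tmul_sum, assoc_tmul]
  exact Finset.sum_comm

theorem coactVec_counit (u : S) :
    rid A S (map LinearMap.id (eval A B S) (e.coactVec B u)) = u := by
  simp only [coactVec_apply, map_sum, map_tmul, LinearMap.id_apply, eval_tmul, rid_tmul, e.sum_eq]

variable (B) in
/-- The left coaction `f ↦ f ⊗ e` on `S*`. -/
def coactCovec : RDual A S →ₗ[A] BTensor A (BTensor B (RDual A S) S) (RDual A S) where
  toFun f := ∑ i, tmul A (tmul B f (e.vec i)) (e.covec i)
  map_add' f g := by simp only [add_tmul, Finset.sum_add_distrib]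
  map_smul' a f := by simp only [RingHom.id_apply, Finset.smul_sum, left_smul_tmul]

theorem coactCovec_apply (f : RDual A S) :
    e.coactCovec B f = ∑ i, tmul A (tmul B f (e.vec i)) (e.covec i) := rfl

theorem coactCovec_coassoc (f : RDual A S) :
    assoc (map (e.insertRight A B S (RDual A S)) LinearMap.id (e.coactCovec B f)) =
      map LinearMap.id (e.coactCovec B) (e.coactCovec B f) := by
  simp only [coactCovec_apply, insertRight, LinearMap.coe_mk, AddHom.coe_mk, insert_tmul, map_sum,
    map_tmul, LinearMap.id_apply, sum_tmul, tmul_sum, assoc_tmul]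
  exact Finset.sum_comm

theorem coactCovec_counit (f : RDual A S) :
    lid A _ (map (toRightLinear (eval A B S) eval_op_smul) LinearMap.id (e.coactCovec B f)) =
      f := by
  simp only [coactCovec_apply, map_sum, map_tmul, LinearMap.id_apply, toRightLinear,
    LinearMap.coe_mk, AddHom.coe_mk, eval_tmul, lid_tmul, e.sum_smul]

variable (B) in
/-- The comatrix coring `S* ⊗_B S`, with `Δ (f ⊗ u) = f ⊗ e ⊗ u` and `ε (f ⊗ u) = f u`. -/
def coring : Coring A where
  carrier := BTensor B (RDual A S) S
  comul := e.insertLeft A B S S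
  comul_op_smul := e.insert_op_smul
  counit := eval A B S
  counit_op_smul := eval_op_smul
  coassoc := e.insert_coassoc
  counit_comul := e.eval_insert
  comul_counit := e.insert_eval

variable (B) in
/-- `S` as a right comodule over the comatrix coring. -/
def rightComodule : RightComodule (e.coring B) where
  carrier := S
  coact := e.coactVec B
  coassoc := e.coactVec_coassoc
  counit := e.coactVec_counit

variable (B) in
/-- `S*` as a left comodule over the comatrix coring. -/
def leftComodule : LeftComodule (e.coring B) where
  carrier := RDual A S
  coact := e.coactCovec B
  coassoc := e.coactCovec_coassoc
  counit := e.coactCovec_counit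

/-! ## The adjunctions `(K, R)` and `(K', R')` -/

section Functors

theorem insert_natural_left {M M' N : Type u} [AddCommGroup M] [Module Bᵐᵒᵖ M] [AddCommGroup M']
    [Module Bᵐᵒᵖ M'] [AddCommGroup N] [Module B N] (g : M →ₗ[Bᵐᵒᵖ] M')
    (g' : BTensor B M S →ₗ[Aᵐᵒᵖ] BTensor B M' S)
    (hg : ∀ x, g' x = map g (LinearMap.id : S →ₗ[B] S) x) (x : BTensor B M N) :
    e.insert M' N (map g LinearMap.id x) = map g' LinearMap.id (e.insert M N x) := by
  induction x using induction_on with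
  | zero => simp
  | tmul m n => simp only [map_tmul, insert_tmul, map_sum, hg, LinearMap.id_apply]
  | add x y hx hy => simp only [map_add, hx, hy]

theorem insert_natural_right {M N N' : Type u} [AddCommGroup M] [Module Bᵐᵒᵖ M] [AddCommGroup N]
    [Module B N] [AddCommGroup N'] [Module B N'] (g : N →ₗ[B] N')
    (g' : BTensor B (RDual A S) N →ₗ[A] BTensor B (RDual A S) N')
    (hg : ∀ x, g' x = map (LinearMap.id : RDual A S →ₗ[Bᵐᵒᵖ] RDual A S) g x)
    (x : BTensor B M N) :
    e.insert M N' (map LinearMap.id g x) = map LinearMap.id g' (e.insert M N x) := by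
  induction x using induction_on with
  | zero => simp
  | tmul m n => simp only [map_tmul, insert_tmul, map_sum, hg, LinearMap.id_apply]
  | add x y hx hy => simp only [map_add, hx, hy]

variable (A S) in
/-- `g ⊗ S` as a right `A`-linear map. -/
def tensorRight {M M' : Type u} [AddCommGroup M] [Module Bᵐᵒᵖ M] [AddCommGroup M']
    [Module Bᵐᵒᵖ M'] (g : M →ₗ[Bᵐᵒᵖ] M') : BTensor B M S →ₗ[Aᵐᵒᵖ] BTensor B M' S where
  toFun := map g LinearMap.id
  map_add' := map_add _
  map_smul' a x := by
    induction x using induction_on with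
    | zero => simp
    | tmul m u => rfl
    | add x y hx hy => simp only [smul_add, map_add, hx, hy]

variable (A S) in
/-- `S* ⊗ g` as a left `A`-linear map. -/
def tensorLeft {N N' : Type u} [AddCommGroup N] [Module B N] [AddCommGroup N']
    [Module B N'] (g : N →ₗ[B] N') :
    BTensor B (RDual A S) N →ₗ[A] BTensor B (RDual A S) N' where
  toFun := map LinearMap.id g
  map_add' := map_add _
  map_smul' a x := by
    induction x using induction_on with
    | zero => simp
    | tmul m u => rfl
    | add x y hx hy => simp only [smul_add, map_add, hx, hy]

/-- `K N = N ⊗_B S` as a right comodule, with coaction `n ⊗ u ↦ n ⊗ e ⊗ u`. -/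
def KObj (N : ModuleCat.{u} Bᵐᵒᵖ) : RightComodule (e.coring B) where
  carrier := BTensor B N S
  coact := e.insertRight A B S N
  coassoc := e.insert_coassoc
  counit := e.insert_eval

/-- The functor `K = - ⊗_B S` from right `B`-modules to right comodules. -/
def K : ModuleCat.{u} Bᵐᵒᵖ ⥤ RightComodule (e.coring B) where
  obj := e.KObj
  map g := ⟨tensorRight A S g.hom,
    e.insert_natural_left g.hom (tensorRight A S g.hom) fun _ => rfl⟩
  map_id _ := Subtype.ext (LinearMap.ext fun x => BTensor.map_id x)
  map_comp f g := Subtype.ext (LinearMap.ext fun x => DFunLike.congr_fun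
    (hom_ext (f := map (f ≫ g).hom LinearMap.id)
      (g := (map g.hom LinearMap.id).comp (map f.hom LinearMap.id)) fun _ _ => rfl) x)

/-- `K' N = S* ⊗_B N` as a left comodule, with coaction `f ⊗ n ↦ f ⊗ e ⊗ n`. -/
def KObj' (N : ModuleCat.{u} B) : LeftComodule (e.coring B) where
  carrier := BTensor B (RDual A S) N
  coact := e.insertLeft A B S N
  coassoc := e.insert_coassoc
  counit := e.eval_insert

/-- The functor `K' = S* ⊗_B -` from left `B`-modules to left comodules. -/
def K' : ModuleCat.{u} B ⥤ LeftComodule (e.coring B) where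
  obj := e.KObj'
  map g := ⟨tensorLeft A S g.hom,
    e.insert_natural_right g.hom (tensorLeft A S g.hom) fun _ => rfl⟩
  map_id _ := Subtype.ext (LinearMap.ext fun x => BTensor.map_id x)
  map_comp f g := Subtype.ext (LinearMap.ext fun x => DFunLike.congr_fun
    (hom_ext (f := map LinearMap.id (f ≫ g).hom)
      (g := (map LinearMap.id g.hom).comp (map LinearMap.id f.hom)) fun _ _ => rfl) x)

variable (A S) in
/-- Left multiplication by `b` on `S`. -/
def lmul (b : B) : S →ₗ[Aᵐᵒᵖ] S := DistribSMul.toLinearMap Aᵐᵒᵖ S b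

variable (A S) in
/-- Right multiplication by `b` on `S*`. -/
def rmul (b : Bᵐᵒᵖ) : RDual A S →ₗ[A] RDual A S where
  toFun f := b • f
  map_add' := smul_add b
  map_smul' a f := (smul_comm a b f).symm

theorem lmul_colinear (b : B) (u : S) :
    e.coactVec B (lmul A S b u) = map (lmul A S b) LinearMap.id (e.coactVec B u) := by
  have h := congrArg (map LinearMap.id (mkLeft B (RDual A S) A u)) (e.smul_elt b)
  simp only [elt, Finset.smul_sum, left_smul_tmul, right_smul_tmul, map_sum, map_tmul,
    LinearMap.id_apply, mkLeft_apply, smul_tmul] at h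
  simp only [coactVec_apply, map_sum, map_tmul, LinearMap.id_apply]
  exact h.symm

theorem rmul_colinear (b : Bᵐᵒᵖ) (f : RDual A S) :
    e.coactCovec B (rmul A S b f) = map LinearMap.id (rmul A S b) (e.coactCovec B f) := by
  have h := congrArg (map (mkRight B S A f) LinearMap.id) (e.smul_elt b.unop)
  simp only [elt, Finset.smul_sum, left_smul_tmul, right_smul_tmul, map_sum,
    map_tmul, LinearMap.id_apply, mkRight_apply, ← smul_tmul] at h
  simp only [coactCovec_apply, map_sum, map_tmul, LinearMap.id_apply]
  exact h

/-- The right `B`-action on `Hom^D(S, M)`: `(φ b) u = φ (b u)`. -/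
instance (M : RightComodule (e.coring B)) :
    Module Bᵐᵒᵖ (RightComodule.colinear (e.rightComodule B) M) where
  smul b φ := ⟨φ.1.comp (lmul A S b.unop),
    (show e.rightComodule B ⟶ M from
      (show e.rightComodule B ⟶ e.rightComodule B from
        ⟨lmul A S b.unop, e.lmul_colinear b.unop⟩) ≫ φ).2⟩
  one_smul φ := Subtype.ext (LinearMap.ext fun u => congrArg φ.1 (one_smul B (show S from u)))
  mul_smul b b' φ := Subtype.ext (LinearMap.ext fun u =>
    congrArg φ.1 (mul_smul b'.unop b.unop (show S from u)))
  smul_zero _ := rfl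
  smul_add _ _ _ := rfl
  add_smul b b' φ := Subtype.ext (LinearMap.ext fun u =>
    (congrArg φ.1 (add_smul b.unop b'.unop (show S from u))).trans (map_add φ.1 _ _))
  zero_smul φ := Subtype.ext (LinearMap.ext fun u =>
    (congrArg φ.1 (zero_smul B (show S from u))).trans (map_zero φ.1))

/-- The left `B`-action on `Hom^D(S*, M)`: `(b φ) f = φ (f b)`. -/
instance (M : LeftComodule (e.coring B)) :
    Module B (LeftComodule.colinear (e.leftComodule B) M) where
  smul b φ := ⟨φ.1.comp (rmul A S (op b)),
    (show e.leftComodule B ⟶ M from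
      (show e.leftComodule B ⟶ e.leftComodule B from
        ⟨rmul A S (op b), e.rmul_colinear (op b)⟩) ≫ φ).2⟩
  one_smul φ := Subtype.ext (LinearMap.ext fun f =>
    congrArg φ.1 (one_smul Bᵐᵒᵖ (show RDual A S from f)))
  mul_smul b b' φ := Subtype.ext (LinearMap.ext fun f =>
    congrArg φ.1 (mul_smul (op b') (op b) (show RDual A S from f)))
  smul_zero _ := rfl
  smul_add _ _ _ := rfl
  add_smul b b' φ := Subtype.ext (LinearMap.ext fun f =>
    (congrArg φ.1 (add_smul (op b) (op b') (show RDual A S from f))).trans (map_add φ.1 _ _))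
  zero_smul φ := Subtype.ext (LinearMap.ext fun f =>
    (congrArg φ.1 (zero_smul Bᵐᵒᵖ (show RDual A S from f))).trans (map_zero φ.1))

/-- The functor `R = Hom^D(S, -)` from right comodules to right `B`-modules. -/
def R : RightComodule (e.coring B) ⥤ ModuleCat.{u} Bᵐᵒᵖ where
  obj M := ModuleCat.of Bᵐᵒᵖ (RightComodule.colinear (e.rightComodule B) M)
  map {M M'} g := ModuleCat.ofHom
    { toFun := fun φ => show e.rightComodule B ⟶ M' from
        (show e.rightComodule B ⟶ M from φ) ≫ g
      map_add' := fun φ ψ => Subtype.ext (LinearMap.ext fun u => map_add g.1 (φ.1 u) (ψ.1 u))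
      map_smul' := fun _ _ => rfl }

/-- The functor `R' = Hom^D(S*, -)` from left comodules to left `B`-modules. -/
def R' : LeftComodule (e.coring B) ⥤ ModuleCat.{u} B where
  obj M := ModuleCat.of B (LeftComodule.colinear (e.leftComodule B) M)
  map {M M'} g := ModuleCat.ofHom
    { toFun := fun φ => show e.leftComodule B ⟶ M' from
        (show e.leftComodule B ⟶ M from φ) ≫ g
      map_add' := fun φ ψ => Subtype.ext (LinearMap.ext fun u => map_add g.1 (φ.1 u) (ψ.1 u))
      map_smul' := fun _ _ => rfl }

theorem mkRight_colinear {N : Type u} [AddCommGroup N] [Module Bᵐᵒᵖ N] (n : N) (u : S) :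
    e.insert N S (tmul B n u) = map (mkRight B S A n) LinearMap.id (e.coactVec B u) := by
  simp only [insert_tmul, coactVec_apply, map_sum, map_tmul, LinearMap.id_apply, mkRight_apply]

theorem mkLeft_colinear {N : Type u} [AddCommGroup N] [Module B N] (f : RDual A S) (n : N) :
    e.insert (RDual A S) N (tmul B f n) =
      map LinearMap.id (mkLeft B (RDual A S) A n) (e.coactCovec B f) := by
  simp only [insert_tmul, coactCovec_apply, map_sum, map_tmul, LinearMap.id_apply, mkLeft_apply]

/-- The colinear map `u ↦ n ⊗ u`. -/
def unitHom (N : ModuleCat.{u} Bᵐᵒᵖ) (n : N) :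
    RightComodule.colinear (e.rightComodule B) (e.K.obj N) :=
  ⟨mkRight B S A n, e.mkRight_colinear n⟩

/-- The colinear map `f ↦ f ⊗ n`. -/
def unitHom' (N : ModuleCat.{u} B) (n : N) :
    LeftComodule.colinear (e.leftComodule B) (e.K'.obj N) :=
  ⟨mkLeft B (RDual A S) A n, fun f => e.mkLeft_colinear f n⟩

/-- The unit `η_N n u = n ⊗ u`. -/
def unit : 𝟭 (ModuleCat.{u} Bᵐᵒᵖ) ⟶ e.K ⋙ e.R where
  app N := ModuleCat.ofHom
    { toFun := e.unitHom N
      map_add' := fun n n' => Subtype.ext (LinearMap.ext fun u => add_tmul n n' (show S from u))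
      map_smul' := fun b n => Subtype.ext (LinearMap.ext fun u => smul_tmul n b.unop (show S from u)) }

/-- The unit `η'_N n f = f ⊗ n`. -/
def unit' : 𝟭 (ModuleCat.{u} B) ⟶ e.K' ⋙ e.R' where
  app N := ModuleCat.ofHom
    { toFun := e.unitHom' N
      map_add' := fun n n' => Subtype.ext (LinearMap.ext fun f => tmul_add (show RDual A S from f) n n')
      map_smul' := fun b n => Subtype.ext (LinearMap.ext fun f =>
        (smul_tmul (show RDual A S from f) b n).symm) }

/-- The map `φ ⊗ u ↦ φ u`. -/
def evalRight (M : RightComodule (e.coring B)) :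
    BTensor B (RightComodule.colinear (e.rightComodule B) M) S →ₗ[Aᵐᵒᵖ] M.carrier where
  toFun := lift
    (fun (φ : RightComodule.colinear (e.rightComodule B) M) (u : S) => φ.1 u)
    (fun _ _ _ => rfl) (fun φ => map_add φ.1) (fun _ _ _ => rfl)
  map_add' := map_add _
  map_smul' a x := by
    induction x using induction_on with
    | zero => rw [smul_zero, map_zero, smul_zero]
    | tmul φ u => exact map_smul φ.1 a u
    | add x y hx hy => rw [smul_add, map_add, map_add, smul_add, hx, hy]

/-- The map `f ⊗ φ ↦ φ f`. -/
def evalLeft (M : LeftComodule (e.coring B)) :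
    BTensor B (RDual A S) (LeftComodule.colinear (e.leftComodule B) M) →ₗ[A] M.carrier where
  toFun := lift
    (fun (f : RDual A S) (φ : LeftComodule.colinear (e.leftComodule B) M) => φ.1 f)
    (fun f g φ => map_add φ.1 f g) (fun _ _ _ => rfl) (fun _ _ _ => rfl)
  map_add' := map_add _
  map_smul' a x := by
    induction x using induction_on with
    | zero => rw [smul_zero, map_zero, smul_zero]
    | tmul f φ => exact map_smul φ.1 a f
    | add x y hx hy => rw [smul_add, map_add, map_add, smul_add, hx, hy]

theorem evalRight_colinear (M : RightComodule (e.coring B))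
    (x : BTensor B (RightComodule.colinear (e.rightComodule B) M) S) :
    M.coact (e.evalRight M x) = map (e.evalRight M) LinearMap.id (e.insert _ S x) := by
  induction x using induction_on with
  | zero =>
    simp only [map_zero]
    rfl
  | tmul φ u =>
    refine (φ.2 u).trans ?_
    refine (map_sum (map φ.1 LinearMap.id)
      (fun i => tmul A (e.vec i) (tmul B (e.covec i) u)) Finset.univ).trans ?_
    rw [insert_tmul, map_sum]
    rfl
  | add x y hx hy =>
    simp only [map_add, hx, hy]
    rfl

theorem evalLeft_colinear (M : LeftComodule (e.coring B))
    (x : BTensor B (RDual A S) (LeftComodule.colinear (e.leftComodule B) M)) :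
    M.coact (e.evalLeft M x) = map LinearMap.id (e.evalLeft M) (e.insert (RDual A S) _ x) := by
  induction x using induction_on with
  | zero =>
    simp only [map_zero]
    rfl
  | tmul f φ =>
    refine (φ.2 f).trans ?_
    refine (map_sum (map LinearMap.id φ.1)
      (fun i => tmul A (tmul B f (e.vec i)) (e.covec i)) Finset.univ).trans ?_
    rw [insert_tmul, map_sum]
    rfl
  | add x y hx hy =>
    simp only [map_add, hx, hy]
    rfl

/-- The colinear map `φ ⊗ u ↦ φ u`. -/
def counitHom (M : RightComodule (e.coring B)) : e.K.obj (e.R.obj M) ⟶ M :=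
  ⟨e.evalRight M, e.evalRight_colinear M⟩

/-- The colinear map `f ⊗ φ ↦ φ f`. -/
def counitHom' (M : LeftComodule (e.coring B)) : e.K'.obj (e.R'.obj M) ⟶ M :=
  ⟨e.evalLeft M, e.evalLeft_colinear M⟩

/-- The counit `ε_M (φ ⊗ u) = φ u`. -/
def counit : e.R ⋙ e.K ⟶ 𝟭 (RightComodule (e.coring B)) where
  app := e.counitHom
  naturality M M' g := Subtype.ext (LinearMap.ext fun x => DFunLike.congr_fun
    (hom_ext (f := (e.counitHom M').1.toAddMonoidHom.comp (e.K.map (e.R.map g)).1.toAddMonoidHom)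
      (g := g.1.toAddMonoidHom.comp (e.counitHom M).1.toAddMonoidHom) fun _ _ => rfl) x)

/-- The counit `ε'_M (f ⊗ φ) = φ f`. -/
def counit' : e.R' ⋙ e.K' ⟶ 𝟭 (LeftComodule (e.coring B)) where
  app := e.counitHom'
  naturality M M' g := Subtype.ext (LinearMap.ext fun x => DFunLike.congr_fun
    (hom_ext
      (f := (e.counitHom' M').1.toAddMonoidHom.comp (e.K'.map (e.R'.map g)).1.toAddMonoidHom)
      (g := g.1.toAddMonoidHom.comp (e.counitHom' M).1.toAddMonoidHom) fun _ _ => rfl) x)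

/-- The adjunction `K ⊣ R`. -/
def adj : (e.K : ModuleCat.{u} Bᵐᵒᵖ ⥤ RightComodule (e.coring B)) ⊣ e.R where
  unit := e.unit
  counit := e.counit
  left_triangle_components N := Subtype.ext (LinearMap.ext fun x => DFunLike.congr_fun
    (hom_ext (f := (e.counitHom (e.K.obj N)).1.toAddMonoidHom.comp
        (e.K.map (e.unit.app N)).1.toAddMonoidHom)
      (g := AddMonoidHom.id _) fun _ _ => rfl) x)
  right_triangle_components _ := rfl

/-- The adjunction `K' ⊣ R'`. -/
def adj' : (e.K' : ModuleCat.{u} B ⥤ LeftComodule (e.coring B)) ⊣ e.R' where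
  unit := e.unit'
  counit := e.counit'
  left_triangle_components N := Subtype.ext (LinearMap.ext fun x => DFunLike.congr_fun
    (hom_ext (f := (e.counitHom' (e.K'.obj N)).1.toAddMonoidHom.comp
        (e.K'.map (e.unit'.app N)).1.toAddMonoidHom)
      (g := AddMonoidHom.id _) fun _ _ => rfl) x)
  right_triangle_components _ := rfl

end Functors

end FiniteDualBasis

/-- An adjoint pair is a pair of inverse equivalences: unit and counit are isomorphisms. -/
def IsInverseEquivalences {X Y : Type*} [Category X] [Category Y] {F : X ⥤ Y} {G : Y ⥤ X}
    (adj : F ⊣ G) : Prop :=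
  IsIso adj.unit ∧ IsIso adj.counit

end Comatrix

end

/-! Write `X⁺` for the character group `Hom(X, ℚ/ℤ)`, with `AddCircle (1 : ℚ)` in the role of `ℚ/ℤ`.
Since `S` is finitely generated projective, `W ⊗_A S* ≅ Hom_A(S, W)` via `x ↦ toHom x`, with inverse
`φ ↦ φ(e)`. Hence `n ⊗ e = 0` if and only if `n ⊗ u = 0` for all `u`, so purity of `l` is total
faithfulness. Faithfulness of `K` alone is also equivalent to total faithfulness: test it on the
maps `B → N`.

The hypothesis on `S` says that `B` acts on `S` through central elements of `End_A(S)`. Total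
faithfulness, applied to the module `B` itself, kills all commutators of `B`, so `B` is commutative.
Rank one endomorphisms `v ↦ u k(v)` are `B`-linear, which lets `S* ⊗_B N` and `N ⊗_B S` be compared
and identifies total faithfulness of `S` with that of `S*`.

The core is that total faithfulness makes the counit bijective; the argument is descent along a pure
map. Let `T N = (N ⊗_B S) ⊗_A S*` and let `η : N → T N` be `n ↦ n ⊗ e` (`insertElt`), which is
injective for every `N`. Taking `N = B⁺` and using that `ℚ/ℤ` is injective, extend the character `ξ
↦ ξ(1)` along `η` to some `Θ`. Every character of every `N` is the pullback of `ξ ↦ ξ(1)` along a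
linear map `N → B⁺`, so this single `Θ` extends all characters along `η` (`extendCharacter`),
additively in the character and naturally in `N`.

For a comodule `M` put `X = M ⊗_A S*`. Then `Hom^D(S, M)` is the equalizer of `η` and of the map `d
: X → T X` given by the coaction, and coassociativity reads `T d ∘ d = T η ∘ d`. If a character `χ`
of `X` vanishes on the equalizer, it has the form `ω ∘ (d - η)`; by naturality its extension is that
of `ω` composed with `T d - T η`, and so it vanishes on the image of `d`
(`extendCharacter_coactDual`). To pass from this to `Hom^D(S, M) ⊗_B S → M`, the extension must be
compatible with the action of `B`; this is where centrality and commutativity enter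
(`extendCharacter_op_smul`). Injectivity and surjectivity are then checked on characters.

Once the counit is an isomorphism, the triangle identity makes `K` of the unit an isomorphism, and
`K`, being faithful on a balanced category, reflects it. The statements for `K'` are the mirror
images. -/

noncomputable section

namespace Comatrix

open BTensor

/-! ## Characters of abelian groups -/

section Characters

variable {P Q : Type*} [AddCommGroup P] [AddCommGroup Q]

/-- A character that vanishes on the kernel of `f` factors through `f`. -/
theorem exists_character_comp_eq (f : P →+ Q) (χ : P →+ AddCircle (1 : ℚ))
    (h : ∀ p, f p = 0 → χ p = 0) : ∃ ω : Q →+ AddCircle (1 : ℚ), ∀ p, ω (f p) = χ p := by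
  -- `P / ker f` embeds in `Q`, and `ℚ/ℤ` is injective, so the character induced on the quotient
  -- extends to `Q`.
  let χ' : CharacterModule (P ⧸ f.ker) := QuotientAddGroup.lift f.ker χ fun p hp => h p hp
  obtain ⟨ω, hω⟩ := CharacterModule.dual_surjective_of_injective
    (R := ℤ) (QuotientAddGroup.kerLift f).toIntLinearMap
    (QuotientAddGroup.kerLift_injective f) χ'
  exact ⟨ω, fun p => DFunLike.congr_fun hω (QuotientAddGroup.mk p)⟩

theorem eq_zero_of_forall_character {p : P} (h : ∀ χ : P →+ AddCircle (1 : ℚ), χ p = 0) :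
    p = 0 :=
  CharacterModule.eq_zero_of_character_apply h

theorem injective_of_character (f : P →+ Q)
    (h : ∀ χ : P →+ AddCircle (1 : ℚ), ∃ ψ : Q →+ AddCircle (1 : ℚ), ∀ p, ψ (f p) = χ p) :
    Function.Injective f := by
  refine (injective_iff_map_eq_zero f).2 fun p hp => eq_zero_of_forall_character fun χ => ?_
  obtain ⟨ψ, hψ⟩ := h χ
  rw [← hψ, hp, map_zero]

/-- A character of `Q` that vanishes on the image is a character of the cokernel; a group without
nonzero characters is zero. -/
theorem surjective_of_character (f : P →+ Q)
    (h : ∀ ψ : Q →+ AddCircle (1 : ℚ), (∀ p, ψ (f p) = 0) → ∀ q, ψ q = 0) :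
    Function.Surjective f := by
  intro q
  have hq : QuotientAddGroup.mk' f.range q = 0 := eq_zero_of_forall_character fun χ =>
    h (χ.comp (QuotientAddGroup.mk' f.range)) (fun p => by
      have hp : QuotientAddGroup.mk' f.range (f p) = 0 :=
        (QuotientAddGroup.eq_zero_iff (f p)).2 (AddMonoidHom.mem_range.2 ⟨p, rfl⟩)
      rw [AddMonoidHom.comp_apply, hp, map_zero]) q
  exact (QuotientAddGroup.eq_zero_iff q).1 hq

end Characters

/-- The character group of a ring, as a right and as a left module over the ring. -/
def RingCharacter (B : Type u) [Ring B] : Type u := B →+ AddCircle (1 : ℚ)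

/-! ### The character module of the ring, through which every character of a module factors -/

namespace RingCharacter

variable {B : Type u} [Ring B]

instance : AddCommGroup (RingCharacter B) := inferInstanceAs (AddCommGroup (B →+ AddCircle (1 : ℚ)))

instance : FunLike (RingCharacter B) B (AddCircle (1 : ℚ)) :=
  inferInstanceAs (FunLike (B →+ AddCircle (1 : ℚ)) B (AddCircle (1 : ℚ)))

instance : AddMonoidHomClass (RingCharacter B) B (AddCircle (1 : ℚ)) :=
  inferInstanceAs (AddMonoidHomClass (B →+ AddCircle (1 : ℚ)) B (AddCircle (1 : ℚ)))

@[ext] theorem ext {ξ η : RingCharacter B} (h : ∀ b, ξ b = η b) : ξ = η := DFunLike.ext _ _ h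

/-- `(ξ b) b' = ξ (b b')` -/
instance : Module Bᵐᵒᵖ (RingCharacter B) where
  smul b ξ := AddMonoidHom.comp ξ (AddMonoidHom.mulLeft b.unop)
  one_smul ξ := ext fun b' => congrArg ξ (one_mul b')
  mul_smul b c ξ := ext fun b' => congrArg ξ (mul_assoc c.unop b.unop b')
  smul_zero _ := rfl
  smul_add _ _ _ := rfl
  add_smul b c ξ := ext fun b' =>
    (congrArg ξ (add_mul b.unop c.unop b')).trans (map_add ξ _ _)
  zero_smul ξ := ext fun b' => (congrArg ξ (zero_mul b')).trans (map_zero ξ)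

/-- `(b ξ) b' = ξ (b' b)` -/
instance : Module B (RingCharacter B) where
  smul b ξ := AddMonoidHom.comp ξ (AddMonoidHom.mulRight b)
  one_smul ξ := ext fun b' => congrArg ξ (mul_one b')
  mul_smul b c ξ := ext fun b' => congrArg ξ (mul_assoc b' b c).symm
  smul_zero _ := rfl
  smul_add _ _ _ := rfl
  add_smul b c ξ := ext fun b' => (congrArg ξ (mul_add b' b c)).trans (map_add ξ _ _)
  zero_smul ξ := ext fun b' => (congrArg ξ (mul_zero b')).trans (map_zero ξ)

theorem op_smul_apply (b : B) (ξ : RingCharacter B) (b' : B) : (op b • ξ) b' = ξ (b * b') := rfl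

theorem smul_apply (b : B) (ξ : RingCharacter B) (b' : B) : (b • ξ) b' = ξ (b' * b) := rfl

/-- The map `n ↦ (b ↦ χ (n b))` for a character `χ` of a right module. -/
def ofRight {N : Type u} [AddCommGroup N] [Module Bᵐᵒᵖ N] (χ : N →+ AddCircle (1 : ℚ)) :
    N →ₗ[Bᵐᵒᵖ] RingCharacter B where
  toFun n := χ.comp (AddMonoidHom.mk' (fun b : B => op b • n) fun b b' => add_smul (op b) (op b') n)
  map_add' n n' := ext fun b => (congrArg χ (smul_add (op b) n n')).trans (map_add χ _ _)
  map_smul' b n := ext fun b' => congrArg χ (mul_smul (op b') b n).symm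

theorem ofRight_apply {N : Type u} [AddCommGroup N] [Module Bᵐᵒᵖ N]
    (χ : N →+ AddCircle (1 : ℚ)) (n : N) (b : B) : ofRight χ n b = χ (op b • n) := rfl

/-- The map `n ↦ (b ↦ χ (b n))` for a character `χ` of a left module. -/
def ofLeft {N : Type u} [AddCommGroup N] [Module B N] (χ : N →+ AddCircle (1 : ℚ)) :
    N →ₗ[B] RingCharacter B where
  toFun n := χ.comp (AddMonoidHom.mk' (fun b : B => b • n) fun b b' => add_smul b b' n)
  map_add' n n' := ext fun b => (congrArg χ (smul_add b n n')).trans (map_add χ _ _)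
  map_smul' b n := ext fun b' => congrArg χ (mul_smul b' b n).symm

theorem ofLeft_apply {N : Type u} [AddCommGroup N] [Module B N]
    (χ : N →+ AddCircle (1 : ℚ)) (n : N) (b : B) : ofLeft χ n b = χ (b • n) := rfl

end RingCharacter

/-! ## More on tensor products -/

namespace BTensor

section

variable {R : Type*} [Ring R] {M N M' N' : Type*}
  [AddCommGroup M] [Module Rᵐᵒᵖ M] [AddCommGroup N] [Module R N]
  [AddCommGroup M'] [Module Rᵐᵒᵖ M'] [AddCommGroup N'] [Module R N']

variable (N) in
/-- `g ⊗ N` as a right linear map. -/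
def mapRight (T : Type*) [Ring T] [Module Tᵐᵒᵖ N] [SMulCommClass R Tᵐᵒᵖ N]
    (g : M →ₗ[Rᵐᵒᵖ] M') : BTensor R M N →ₗ[Tᵐᵒᵖ] BTensor R M' N where
  toFun := map g LinearMap.id
  map_add' := map_add _
  map_smul' t x := by
    induction x using induction_on with
    | zero => simp
    | tmul m n => rfl
    | add x y hx hy => simp only [smul_add, map_add, hx, hy]

variable (M) in
/-- `M ⊗ g` as a left linear map. -/
def mapLeft (L : Type*) [Ring L] [Module L M] [SMulCommClass L Rᵐᵒᵖ M]
    (g : N →ₗ[R] N') : BTensor R M N →ₗ[L] BTensor R M N' where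
  toFun := map LinearMap.id g
  map_add' := map_add _
  map_smul' l x := by
    induction x using induction_on with
    | zero => simp
    | tmul m n => rfl
    | add x y hx hy => simp only [smul_add, map_add, hx, hy]

theorem map_comp_id {M'' : Type*} [AddCommGroup M''] [Module Rᵐᵒᵖ M''] (g : M' →ₗ[Rᵐᵒᵖ] M'')
    (f : M →ₗ[Rᵐᵒᵖ] M') (x : BTensor R M N) :
    map (g.comp f) LinearMap.id x = map g LinearMap.id (map f (LinearMap.id : N →ₗ[R] N) x) :=
  DFunLike.congr_fun (hom_ext (f := map (g.comp f) LinearMap.id)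
    (g := (map g LinearMap.id).comp (map f LinearMap.id)) fun _ _ => rfl) x

theorem map_id_comp {N'' : Type*} [AddCommGroup N''] [Module R N''] (g : N' →ₗ[R] N'')
    (f : N →ₗ[R] N') (x : BTensor R M N) :
    map LinearMap.id (g.comp f) x = map LinearMap.id g (map (LinearMap.id : M →ₗ[Rᵐᵒᵖ] M) f x) :=
  DFunLike.congr_fun (hom_ext (f := map LinearMap.id (g.comp f))
    (g := (map LinearMap.id g).comp (map LinearMap.id f)) fun _ _ => rfl) x

end

section Assoc

variable {R T : Type*} [Ring R] [Ring T] {M N P : Type*} [AddCommGroup M]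
    [Module Rᵐᵒᵖ M] [AddCommGroup N] [Module R N] [Module Tᵐᵒᵖ N] [SMulCommClass R Tᵐᵒᵖ N]
    [AddCommGroup P] [Module T P]

/-- The canonical map `M ⊗ (N ⊗ P) → (M ⊗ N) ⊗ P`. -/
def assocSymm : BTensor R M (BTensor T N P) →+ BTensor T (BTensor R M N) P :=
  lift (fun m x => lift (R := T) (fun n p => tmul T (tmul R m n) p)
      (fun n n' p => by rw [tmul_add, add_tmul])
      (fun n p p' => tmul_add _ _ _)
      (fun n t p => by rw [← right_smul_tmul, smul_tmul]) x)
    (fun m m' x => by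
      rw [← AddMonoidHom.add_apply]
      exact DFunLike.congr_fun (hom_ext fun n p => by simp [add_tmul]) x)
    (fun m x x' => map_add _ _ _)
    (fun m r x => by
      induction x using induction_on with
      | zero => simp
      | tmul n p => simp only [left_smul_tmul, lift_tmul, smul_tmul]
      | add x y hx hy => simp only [smul_add, map_add, hx, hy])

@[simp]
theorem assocSymm_tmul (m : M) (n : N) (p : P) :
    assocSymm (tmul R m (tmul T n p)) = tmul T (tmul R m n) p := rfl

/-- `assocSymm` as a right linear map. -/
def assocSymmRight (Q : Type*) [Ring Q] [Module Qᵐᵒᵖ P] [SMulCommClass T Qᵐᵒᵖ P] :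
    BTensor R M (BTensor T N P) →ₗ[Qᵐᵒᵖ] BTensor T (BTensor R M N) P where
  toFun := assocSymm
  map_add' := map_add _
  map_smul' q x := by
    induction x using induction_on with
    | zero => simp
    | tmul m y =>
      induction y using induction_on with
      | zero => simp [tmul_zero]
      | tmul n p => rfl
      | add x y hx hy => simp only [tmul_add, smul_add, map_add, hx, hy]
    | add x y hx hy => simp only [smul_add, map_add, hx, hy]

/-- `assoc` as a left linear map. -/
def assocLeft (L : Type*) [Ring L] [Module L M] [SMulCommClass L Rᵐᵒᵖ M] :
    BTensor T (BTensor R M N) P →ₗ[L] BTensor R M (BTensor T N P) where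
  toFun := assoc
  map_add' := map_add _
  map_smul' l x := by
    induction x using induction_on with
    | zero => simp
    | tmul y p =>
      induction y using induction_on with
      | zero => simp [zero_tmul]
      | tmul m n => rfl
      | add x y hx hy => simp only [add_tmul, smul_add, map_add, hx, hy]
    | add x y hx hy => simp only [smul_add, map_add, hx, hy]

end Assoc

end BTensor

namespace FiniteDualBasis

variable {A B S : Type u} [Ring A] [Ring B] [AddCommGroup S] [Module B S] [Module Aᵐᵒᵖ S]
  [SMulCommClass B Aᵐᵒᵖ S] (e : FiniteDualBasis A S)

/-! ## The right hand side -/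

section Right

/-- The map `w ⊗ f ↦ w (f u)`. -/
def evalAt {W : Type u} [AddCommGroup W] [Module Aᵐᵒᵖ W] (u : S) :
    BTensor A W (RDual A S) →+ W :=
  lift (fun w f => op (f u) • w) (fun w w' _ => smul_add _ w w')
    (fun w f f' => add_smul (op (f u)) (op (f' u)) w)
    (fun w a f => (mul_smul (op (f u)) (op a) w).symm)

@[simp] theorem evalAt_tmul {W : Type u} [AddCommGroup W] [Module Aᵐᵒᵖ W] (u : S) (w : W)
    (f : RDual A S) : evalAt u (tmul A w f) = op (f u) • w := rfl

theorem evalAt_add {W : Type u} [AddCommGroup W] [Module Aᵐᵒᵖ W] (u v : S)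
    (x : BTensor A W (RDual A S)) : evalAt (u + v) x = evalAt u x + evalAt v x := by
  rw [← AddMonoidHom.add_apply]
  exact DFunLike.congr_fun (hom_ext fun w f => by simp [add_smul]) x

theorem evalAt_op_smul {W : Type u} [AddCommGroup W] [Module Aᵐᵒᵖ W] (a : Aᵐᵒᵖ) (u : S)
    (x : BTensor A W (RDual A S)) : evalAt (a • u) x = a • evalAt u x := by
  induction x using induction_on with
  | zero => simp
  | tmul w f => simp [mul_smul]
  | add x y hx hy => simp only [smul_add, map_add, hx, hy]

theorem evalAt_smul {W : Type u} [AddCommGroup W] [Module Aᵐᵒᵖ W] (b : B) (u : S)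
    (x : BTensor A W (RDual A S)) : evalAt (b • u) x = evalAt u (op b • x) := by
  induction x using induction_on with
  | zero => simp
  | tmul w f => simp [right_smul_tmul]
  | add x y hx hy => simp only [smul_add, map_add, hx, hy]

/-- The right linear map `S → W` that corresponds to an element of `W ⊗ S*`. -/
def toHom {W : Type u} [AddCommGroup W] [Module Aᵐᵒᵖ W] (x : BTensor A W (RDual A S)) :
    S →ₗ[Aᵐᵒᵖ] W where
  toFun u := evalAt u x
  map_add' u v := evalAt_add u v x
  map_smul' a u := evalAt_op_smul a u x

theorem toHom_apply {W : Type u} [AddCommGroup W] [Module Aᵐᵒᵖ W] (x : BTensor A W (RDual A S))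
    (u : S) : toHom x u = evalAt u x := rfl

/-- Together with `map_toHom_elt`, this is the bijection `Hom_A(S, W) ≅ W ⊗_A S*`; both directions
are the dual basis identities. -/
theorem evalAt_map_elt {W : Type u} [AddCommGroup W] [Module Aᵐᵒᵖ W] (φ : S →ₗ[Aᵐᵒᵖ] W) (u : S) :
    evalAt u (map φ LinearMap.id e.elt) = φ u := by
  simp only [elt, map_sum, map_tmul, evalAt_tmul, LinearMap.id_apply, ← map_smul]
  rw [← map_sum, e.sum_eq]

theorem map_toHom_elt {W : Type u} [AddCommGroup W] [Module Aᵐᵒᵖ W]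
    (x : BTensor A W (RDual A S)) : map (toHom x) LinearMap.id e.elt = x := by
  simp only [elt, map_sum, map_tmul, LinearMap.id_apply, toHom_apply]
  induction x using induction_on with
  | zero => simp [zero_tmul]
  | tmul w f => simp only [evalAt_tmul, smul_tmul, ← tmul_sum, e.sum_smul]
  | add x y hx hy => simp only [map_add, add_tmul, Finset.sum_add_distrib, hx, hy]

/-- Because `b e = e b`, precomposition with `b` on `Hom_A(S, W)` becomes the right action on the
factor `S*`. -/
theorem map_comp_lmul_elt {W : Type u} [AddCommGroup W] [Module Aᵐᵒᵖ W] (φ : S →ₗ[Aᵐᵒᵖ] W)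
    (b : B) : map (φ.comp (lmul A S b)) LinearMap.id e.elt =
      op b • map φ LinearMap.id e.elt := by
  have h : map (lmul A S b) LinearMap.id e.elt = op b • e.elt := by
    rw [← smul_elt]; rfl
  rw [map_comp_id, h]
  exact (mapRight (RDual A S) B φ).map_smul (op b) e.elt

/-- The map `N → (N ⊗_B S) ⊗_A S*`, `n ↦ n ⊗ e`. -/
def insertElt (N : Type u) [AddCommGroup N] [Module Bᵐᵒᵖ N] :
    N →ₗ[Bᵐᵒᵖ] BTensor A (BTensor B N S) (RDual A S) where
  toFun n := map (mkRight B S A n) LinearMap.id e.elt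
  map_add' n n' := by
    simp only [elt, map_sum, map_tmul, mkRight_apply, add_tmul, Finset.sum_add_distrib]
  map_smul' b n := by
    rw [RingHom.id_apply, ← op_unop b, ← map_comp_lmul_elt]
    congr 2
    exact LinearMap.ext fun u => smul_tmul n b.unop u

theorem insertElt_apply {N : Type u} [AddCommGroup N] [Module Bᵐᵒᵖ N] (n : N) :
    e.insertElt N n = map (mkRight B S A n) LinearMap.id e.elt := rfl

theorem evalAt_insertElt {N : Type u} [AddCommGroup N] [Module Bᵐᵒᵖ N] (n : N) (u : S) :
    evalAt u (e.insertElt N n) = tmul B n u := e.evalAt_map_elt (mkRight B S A n) u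

theorem hom_ext_tensor_dual {N : Type u} {P : Type*} [AddCommGroup N] [Module Bᵐᵒᵖ N]
    [AddCommGroup P]
    {f g : BTensor A (BTensor B N S) (RDual A S) →+ P}
    (h : ∀ n u k, f (tmul A (tmul B n u) k) = g (tmul A (tmul B n u) k)) : f = g := by
  refine hom_ext fun x k => ?_
  induction x using induction_on with
  | zero => simp [zero_tmul]
  | tmul n u => exact h n u k
  | add x y hx hy => simp only [add_tmul, map_add, hx, hy]

variable (A S) in
/-- The functor `(- ⊗_B S) ⊗_A S*` on maps. -/
def mapTensorDual {N N' : Type u} [AddCommGroup N] [Module Bᵐᵒᵖ N] [AddCommGroup N']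
    [Module Bᵐᵒᵖ N'] (g : N →ₗ[Bᵐᵒᵖ] N') :
    BTensor A (BTensor B N S) (RDual A S) →+ BTensor A (BTensor B N' S) (RDual A S) :=
  map (tensorRight A S g) LinearMap.id

/-- Naturality of `η : N → T N`. -/
theorem mapTensorDual_insertElt {N N' : Type u} [AddCommGroup N] [Module Bᵐᵒᵖ N]
    [AddCommGroup N'] [Module Bᵐᵒᵖ N'] (g : N →ₗ[Bᵐᵒᵖ] N') (n : N) :
    mapTensorDual A S g (e.insertElt N n) = e.insertElt N' (g n) := by
  rw [mapTensorDual, insertElt_apply, ← map_comp_id]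
  rfl

/-- Extension of characters along `N → (N ⊗_B S) ⊗_A S*`, for a suitable `Θ`. -/
def extendCharacter (Θ : BTensor A (BTensor B (RingCharacter B) S) (RDual A S) →+
      AddCircle (1 : ℚ)) {N : Type u} [AddCommGroup N] [Module Bᵐᵒᵖ N]
    (χ : N →+ AddCircle (1 : ℚ)) :
    BTensor A (BTensor B N S) (RDual A S) →+ AddCircle (1 : ℚ) :=
  Θ.comp (mapTensorDual A S (RingCharacter.ofRight χ))

/-! ### Natural extension of characters along `n ↦ n ⊗ e` -/

section ExtendCharacter

variable (Θ : BTensor A (BTensor B (RingCharacter B) S) (RDual A S) →+ AddCircle (1 : ℚ))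
  {N N' : Type u} [AddCommGroup N] [Module Bᵐᵒᵖ N] [AddCommGroup N'] [Module Bᵐᵒᵖ N']

theorem extendCharacter_tmul (χ : N →+ AddCircle (1 : ℚ)) (n : N) (u : S) (k : RDual A S) :
    extendCharacter Θ χ (tmul A (tmul B n u) k) =
      Θ (tmul A (tmul B (RingCharacter.ofRight χ n) u) k) := rfl

theorem extendCharacter_add (χ χ' : N →+ AddCircle (1 : ℚ))
    (y : BTensor A (BTensor B N S) (RDual A S)) :
    extendCharacter Θ (χ + χ') y = extendCharacter Θ χ y + extendCharacter Θ χ' y := by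
  rw [← AddMonoidHom.add_apply]
  refine DFunLike.congr_fun (hom_ext_tensor_dual (f := extendCharacter Θ (χ + χ'))
    (g := extendCharacter Θ χ + extendCharacter Θ χ') fun n u k => ?_) y
  rw [AddMonoidHom.add_apply]
  simp only [extendCharacter_tmul]
  rw [← map_add, ← add_tmul, ← add_tmul]
  rfl

theorem extendCharacter_sub (χ χ' : N →+ AddCircle (1 : ℚ))
    (y : BTensor A (BTensor B N S) (RDual A S)) :
    extendCharacter Θ (χ - χ') y = extendCharacter Θ χ y - extendCharacter Θ χ' y := by
  rw [eq_sub_iff_add_eq, ← extendCharacter_add, sub_add_cancel]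

/-- Naturality in the module: the map `N → B⁺` attached to `χ ∘ g` is the one attached to `χ`,
composed with `g`. -/
theorem extendCharacter_comp (χ : N' →+ AddCircle (1 : ℚ)) (g : N →ₗ[Bᵐᵒᵖ] N')
    (y : BTensor A (BTensor B N S) (RDual A S)) :
    extendCharacter Θ (χ.comp g.toAddMonoidHom) y =
      extendCharacter Θ χ (mapTensorDual A S g y) := by
  refine DFunLike.congr_fun (hom_ext_tensor_dual
    (f := extendCharacter Θ (χ.comp g.toAddMonoidHom))
    (g := (extendCharacter Θ χ).comp (mapTensorDual A S g)) fun n u k => ?_) y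
  have h : RingCharacter.ofRight (χ.comp g.toAddMonoidHom) n = RingCharacter.ofRight χ (g n) :=
    RingCharacter.ext fun b => congrArg χ (g.map_smul (op b) n)
  rw [extendCharacter_tmul, h]
  rfl

theorem extendCharacter_insertElt (hΘ : ∀ ξ, Θ (e.insertElt _ ξ) = ξ 1)
    (χ : N →+ AddCircle (1 : ℚ)) (n : N) : extendCharacter Θ χ (e.insertElt N n) = χ n := by
  rw [extendCharacter, AddMonoidHom.comp_apply, mapTensorDual_insertElt, hΘ,
    RingCharacter.ofRight_apply, op_one, one_smul]

/-- `u ⊗ f b = b u ⊗ f` in `(N ⊗_B S) ⊗_A S*`, if `b` commutes with all endomorphisms of `S`. -/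
theorem tmul_tmul_op_smul (e : FiniteDualBasis A S)
    (h : ∀ (φ : S →ₗ[Aᵐᵒᵖ] S) (b : B) (u : S), φ (b • u) = b • φ u)
    (n : N) (u : S) (b : B) (k : RDual A S) :
    tmul A (tmul B n u) (op b • k) = tmul A (tmul B (op b • n) u) k := by
  -- The rank one endomorphism `v ↦ u k(v)` of `S` commutes with `b`.
  have h1 : ∀ v, op (k (b • v)) • u = b • op (k v) • u := fun v =>
    h (toHom (tmul A u k)) b v
  rw [← e.sum_smul (op b • k), tmul_sum]
  conv_rhs => rw [← e.sum_smul k, tmul_sum]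
  -- With `k b` and `k` expanded in the covectors, the coefficients move across `⊗_A` onto `u`,
  -- where `h1` compares them term by term.
  refine Finset.sum_congr rfl fun i _ => ?_
  rw [← smul_tmul, ← smul_tmul, right_smul_tmul, right_smul_tmul, RDual.op_smul_apply, h1,
    smul_tmul]

/-- Twisting `χ` by `b` multiplies the associated map `N → B⁺` by `b`, since `B` is commutative;
centrality then carries `b` from the factor `N` to the factor `S*`. This makes the pairings `Ψ`
below balanced over `B`. -/
theorem extendCharacter_op_smul (e : FiniteDualBasis A S)
    (h : ∀ (φ : S →ₗ[Aᵐᵒᵖ] S) (b : B) (u : S), φ (b • u) = b • φ u)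
    (hB : ∀ b b' : B, b * b' = b' * b)
    (χ : N →+ AddCircle (1 : ℚ)) (b : B) (y : BTensor A (BTensor B N S) (RDual A S)) :
    extendCharacter Θ (χ.comp (DistribSMul.toAddMonoidHom N (op b))) y =
      extendCharacter Θ χ (op b • y) := by
  refine DFunLike.congr_fun (hom_ext_tensor_dual
    (f := extendCharacter Θ (χ.comp (DistribSMul.toAddMonoidHom N (op b))))
    (g := (extendCharacter Θ χ).comp (DistribSMul.toAddMonoidHom _ (op b))) fun n u k => ?_) y
  have h1 : RingCharacter.ofRight (χ.comp (DistribSMul.toAddMonoidHom N (op b))) n =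
      op b • RingCharacter.ofRight χ n := RingCharacter.ext fun b' => by
    rw [RingCharacter.op_smul_apply, hB]
    exact congrArg χ (mul_smul (op b) (op b') n).symm
  rw [extendCharacter_tmul, h1, ← tmul_tmul_op_smul e h]
  rfl

end ExtendCharacter

/-- The only module to which total faithfulness is applied here is `B⁺`, which lives in the universe
of `B`. It makes `η` injective there, so that `ξ ↦ ξ(1)` extends. -/
theorem exists_character_insertElt (hS : TotallyFaithfulLeft B S) :
    ∃ Θ : BTensor A (BTensor B (RingCharacter B) S) (RDual A S) →+ AddCircle (1 : ℚ),
      ∀ ξ, Θ (e.insertElt _ ξ) = ξ 1 := by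
  refine exists_character_comp_eq (e.insertElt (RingCharacter B)).toAddMonoidHom
    (AddMonoidHom.mk' (fun ξ : RingCharacter B => ξ 1) fun _ _ => rfl) fun ξ hξ => ?_
  have h0 : ξ = 0 := hS _ ξ fun u => by
    rw [← e.evalAt_insertElt, show e.insertElt _ ξ = 0 from hξ, map_zero]
  rw [h0]
  rfl

/-! ### `Hom^D(S, M)` as an equalizer, and its behaviour under characters -/

section Counit

variable (M : RightComodule (e.coring B))

/-- The coaction of `M` with values in `(M ⊗_A S*) ⊗_B S`. -/
def coactAssoc : M.carrier →ₗ[Aᵐᵒᵖ] BTensor B (BTensor A M.carrier (RDual A S)) S :=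
  (assocSymmRight A).comp
    (show M.carrier →ₗ[Aᵐᵒᵖ] BTensor A M.carrier (BTensor B (RDual A S) S) from M.coact)

theorem coactAssoc_apply (m : M.carrier) : e.coactAssoc M m =
    assocSymm (show BTensor A M.carrier (BTensor B (RDual A S) S) from M.coact m) := rfl

/-- The coaction of `M` tensored with `S*`. -/
def coactDual : BTensor A M.carrier (RDual A S) →ₗ[Bᵐᵒᵖ]
    BTensor A (BTensor B (BTensor A M.carrier (RDual A S)) S) (RDual A S) :=
  mapRight (RDual A S) B (e.coactAssoc M)

/-- This is coassociativity of `M` with the brackets moved; tensored with `S*` it becomes `T d ∘ d =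
T η ∘ d`. -/
theorem tensorRight_coactDual (m : M.carrier) :
    tensorRight A S (e.coactDual M) (e.coactAssoc M m) =
      tensorRight A S (e.insertElt _) (e.coactAssoc M m) := by
  -- `J` only moves brackets, from `M ⊗ (D ⊗ D)` to `(((M ⊗ S*) ⊗ S) ⊗ S*) ⊗ S`. Both sides are
  -- shown to be `J` of one side of the coassociativity law.
  let J : BTensor A M.carrier (BTensor A (BTensor B (RDual A S) S) (BTensor B (RDual A S) S)) →+
      BTensor B (BTensor A (BTensor B (BTensor A M.carrier (RDual A S)) S) (RDual A S)) S :=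
    assocSymm.comp ((map (assocSymmRight A) LinearMap.id).comp assocSymm)
  let ρ : M.carrier →ₗ[Aᵐᵒᵖ] BTensor A M.carrier (BTensor B (RDual A S) S) := M.coact
  have h1 : ∀ z : BTensor A M.carrier (BTensor B (RDual A S) S),
      tensorRight A S (e.coactDual M) (assocSymm z) = J (assoc (map ρ LinearMap.id z)) := by
    intro z
    induction z using induction_on with
    | zero => simp
    | tmul m x =>
      induction x using induction_on with
      | zero => simp [tmul_zero]
      | tmul f u =>
        -- The coaction `ρ m` is not a pure tensor, so it is replaced by an arbitrary `w`, on which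
        -- induction is possible.
        have h2 : ∀ w : BTensor A M.carrier (BTensor B (RDual A S) S),
            tmul B (tmul A (assocSymm w) f) u = J (assoc (tmul A w (tmul B f u))) := by
          intro w
          induction w using induction_on with
          | zero => simp [zero_tmul]
          | tmul m x =>
            induction x using induction_on with
            | zero => simp [zero_tmul, tmul_zero]
            | tmul g v => rfl
            | add x y hx hy => simp only [tmul_add, add_tmul, map_add, hx, hy]
          | add x y hx hy => simp only [add_tmul, map_add, hx, hy]
        exact h2 (ρ m)
      | add x y hx hy => simp only [tmul_add, map_add, hx, hy]
    | add x y hx hy => simp only [map_add, hx, hy]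
  have h3 : ∀ z : BTensor A M.carrier (BTensor B (RDual A S) S),
      tensorRight A S (e.insertElt _) (assocSymm z) =
        J (map LinearMap.id (e.insertLeft A B S S) z) := by
    intro z
    induction z using induction_on with
    | zero => simp
    | tmul m x =>
      induction x using induction_on with
      | zero => simp [tmul_zero]
      | tmul f u =>
        have h4 : e.insertLeft A B S S (tmul B f u) =
          ∑ i, tmul A (tmul B f (e.vec i)) (tmul B (e.covec i) u) := e.insert_tmul f u
        rw [map_tmul, h4, tmul_sum, map_sum, assocSymm_tmul]
        refine Eq.trans (b := tmul B (e.insertElt _ (tmul A m f)) u) rfl ?_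
        rw [insertElt_apply, elt, map_sum, sum_tmul]
        rfl
      | add x y hx hy => simp only [tmul_add, map_add, hx, hy]
    | add x y hx hy => simp only [map_add, hx, hy]
  rw [coactAssoc_apply, h1, h3]
  exact congrArg J (M.coassoc m)

theorem mapTensorDual_coactDual (x : BTensor A M.carrier (RDual A S)) :
    mapTensorDual A S (e.coactDual M) (e.coactDual M x) =
      mapTensorDual A S (e.insertElt _) (e.coactDual M x) := by
  induction x using induction_on with
  | zero => simp
  | tmul m f =>
    exact congrArg (fun w => tmul A w f) (e.tensorRight_coactDual M m)
  | add x y hx hy => simp only [map_add, hx, hy]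

/-- The map `Hom^D(S, M) → M ⊗_A S*`, `φ ↦ φ(e)`. -/
def homElt : RightComodule.colinear (e.rightComodule B) M →ₗ[Bᵐᵒᵖ]
    BTensor A M.carrier (RDual A S) where
  toFun φ := map (show S →ₗ[Aᵐᵒᵖ] M.carrier from φ.1) LinearMap.id e.elt
  map_add' φ ψ := by
    rw [elt, map_sum, map_sum, map_sum, ← Finset.sum_add_distrib]
    exact Finset.sum_congr rfl fun i _ => add_tmul _ _ _
  map_smul' b φ := e.map_comp_lmul_elt (show S →ₗ[Aᵐᵒᵖ] M.carrier from φ.1) b.unop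

theorem homElt_apply (φ : RightComodule.colinear (e.rightComodule B) M) :
    e.homElt M φ = map (show S →ₗ[Aᵐᵒᵖ] M.carrier from φ.1) LinearMap.id e.elt := rfl

theorem coactAssoc_homElt (φ : RightComodule.colinear (e.rightComodule B) M) (u : S) :
    e.coactAssoc M (φ.1 u) = tmul B (e.homElt M φ) u := by
  have h : e.coactAssoc M (φ.1 u) = assocSymm (map (show S →ₗ[Aᵐᵒᵖ] M.carrier from φ.1)
    LinearMap.id (e.coactVec B u)) := congrArg assocSymm (φ.2 u)
  rw [h, homElt_apply, coactVec_apply, elt, map_sum, map_sum, map_sum, sum_tmul]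
  rfl

/-- The candidate is `toHom x`. Evaluating the last factor `S*` of the equation `d x = η x` at each
`u` gives exactly the colinearity of this map. -/
theorem exists_homElt_eq (x : BTensor A M.carrier (RDual A S))
    (hx : e.coactDual M x = e.insertElt _ x) : ∃ φ, e.homElt M φ = x := by
  have h1 : ∀ u, e.coactAssoc M (evalAt u x) = tmul B x u := fun u => by
    rw [← e.evalAt_insertElt, ← hx]
    clear hx
    induction x using induction_on with
    | zero => simp
    | tmul m f => exact (e.coactAssoc M).map_smul _ _
    | add x y hx hy => simp only [map_add, hx, hy]
  have h2 : ∀ (m : M.carrier), assoc (e.coactAssoc M m) = M.coact m := fun m => by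
    have h3 : ∀ z : BTensor A M.carrier (BTensor B (RDual A S) S), assoc (assocSymm z) = z := by
      intro z
      induction z using induction_on with
      | zero => simp
      | tmul m x =>
        induction x using induction_on with
        | zero => simp [tmul_zero]
        | tmul f u => rfl
        | add x y hx hy => simp only [tmul_add, map_add, hx, hy]
      | add x y hx hy => simp only [map_add, hx, hy]
    exact h3 _
  have h4 (u : S) : assoc (tmul B (map (toHom x) LinearMap.id e.elt) u) =
      map (toHom x) LinearMap.id (e.coactVec B u) := by
    rw [elt, map_sum, sum_tmul, map_sum, coactVec_apply, map_sum]
    rfl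
  simp only [map_toHom_elt] at h4
  exact ⟨⟨toHom (S := S) x, fun u => (h2 _).symm.trans ((congrArg assoc (h1 u)).trans (h4 u))⟩,
    e.map_toHom_elt x⟩

/-- The map `(m ⊗ f) ⊗ u ↦ m (f u)`. -/
def evalTensor (W : Type u) [AddCommGroup W] [Module Aᵐᵒᵖ W] :
    BTensor B (BTensor A W (RDual A S)) S →+ W :=
  lift (fun x u => evalAt u x) (fun x y _ => map_add _ x y) (fun x u v => evalAt_add u v x)
    (fun x b u => (evalAt_smul b u x).symm)

/-- The counit axiom of `M`, with the brackets moved. -/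
theorem evalTensor_coactAssoc (m : M.carrier) :
    evalTensor M.carrier (e.coactAssoc M m) = m := by
  have h1 : ∀ z : BTensor A M.carrier (BTensor B (RDual A S) S),
      evalTensor M.carrier (assocSymm z) = rid A _ (map LinearMap.id (eval A B S) z) := by
    intro z
    induction z using induction_on with
    | zero => simp
    | tmul m x =>
      induction x using induction_on with
      | zero => simp [tmul_zero]
      | tmul f u => rfl
      | add x y hx hy => simp only [tmul_add, map_add, hx, hy]
    | add x y hx hy => simp only [map_add, hx, hy]
  exact (h1 _).trans (M.counit m)

/-- The splitting argument: `χ = ω ∘ (d - η)`, naturality turns its extension into that of `ω`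
composed with `T d - T η`, and this difference kills `d x` by coassociativity. -/
theorem extendCharacter_coactDual
    (Θ : BTensor A (BTensor B (RingCharacter B) S) (RDual A S) →+ AddCircle (1 : ℚ))
    (χ : BTensor A M.carrier (RDual A S) →+ AddCircle (1 : ℚ))
    (hχ : ∀ φ, χ (e.homElt M φ) = 0) (x : BTensor A M.carrier (RDual A S)) :
    extendCharacter Θ χ (e.coactDual M x) = 0 := by
  -- The kernel of `d - η` consists of elements `φ(e)` with `φ` colinear, where `χ` vanishes by
  -- assumption.
  obtain ⟨ω, hω⟩ := exists_character_comp_eq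
    ((e.coactDual M).toAddMonoidHom - (e.insertElt _).toAddMonoidHom) χ fun x hx => by
      obtain ⟨φ, rfl⟩ := e.exists_homElt_eq M x (sub_eq_zero.1 hx)
      exact hχ φ
  have h : χ = ω.comp (e.coactDual M).toAddMonoidHom - ω.comp (e.insertElt _).toAddMonoidHom := by
    ext y
    rw [← hω y]
    exact map_sub ω _ _
  rw [h, extendCharacter_sub, extendCharacter_comp, extendCharacter_comp,
    mapTensorDual_coactDual, sub_self]

end Counit

end Right

/-! ### Bijectivity of the counit of `(K, R)` -/

section RightCounit

variable (M : RightComodule (e.coring B))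

/-- Colinearity of `φ` says that the coaction after `φ` is `u ↦ φ(e) ⊗ u`; applying this to `e` puts
`φ(e)` in the equalizer. -/
theorem coactDual_homElt (φ : RightComodule.colinear (e.rightComodule B) M) :
    e.coactDual M (e.homElt M φ) = e.insertElt _ (e.homElt M φ) := by
  refine (map_comp_id (e.coactAssoc M) (show S →ₗ[Aᵐᵒᵖ] M.carrier from φ.1) e.elt).symm.trans ?_
  have h : (e.coactAssoc M).comp (show S →ₗ[Aᵐᵒᵖ] M.carrier from φ.1) =
      mkRight B S A (e.homElt M φ) := LinearMap.ext fun u => e.coactAssoc_homElt M φ u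
  rw [h, insertElt_apply]

theorem homElt_injective : Function.Injective (e.homElt M) := fun φ ψ h =>
  Subtype.ext (LinearMap.ext fun (u : S) => by
    have h1 := congrArg (evalAt u) h
    rw [homElt_apply, homElt_apply, evalAt_map_elt, evalAt_map_elt] at h1
    exact h1)

variable (h : ∀ (φ : S →ₗ[Aᵐᵒᵖ] S) (b : B) (u : S), φ (b • u) = b • φ u)
include h

theorem smul_smul_comm (b b' : B) (u : S) : b • b' • u = b' • b • u :=
  h (lmul A S b) b' u

/-- Commutators act as zero on `S`, because left multiplications are themselves `A`-linear
endomorphisms. Total faithfulness, tested on the right module `B`, makes them vanish. -/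
theorem mul_comm_of_totallyFaithfulLeft (hS : TotallyFaithfulLeft B S) (b b' : B) :
    b * b' = b' * b := by
  refine sub_eq_zero.1 (hS B (b * b' - b' * b) fun u => ?_)
  have h1 : tmul B (op (b * b' - b' * b) • (1 : B)) u = 0 := by
    rw [smul_tmul, sub_smul, mul_smul, mul_smul, smul_smul_comm h, sub_self, tmul_zero]
  rwa [op_smul_eq_mul, one_mul] at h1

variable (hS : TotallyFaithfulLeft B S)
include hS

/-- A character `ψ` of `M` that kills all values `φ s` has to vanish. The characters `m ⊗ f ↦ ψ(m
f(s))` of `M ⊗_A S*` vanish on the equalizer, so their extensions vanish on the image of `d`. -/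
theorem evalRight_surjective : Function.Surjective (e.evalRight M) := by
  have hB := mul_comm_of_totallyFaithfulLeft h hS
  obtain ⟨Θ, hΘ⟩ := e.exists_character_insertElt hS
  refine surjective_of_character (e.evalRight M).toAddMonoidHom fun ψ hψ m => ?_
  let χ : S → BTensor A M.carrier (RDual A S) →+ AddCircle (1 : ℚ) := fun s =>
    ψ.comp (evalAt s)
  have hχ : ∀ s φ, χ s (e.homElt M φ) = 0 := fun s φ => by
    rw [homElt_apply]
    exact (congrArg ψ (e.evalAt_map_elt _ s)).trans (hψ (tmul B φ s))
  -- All the extensions for varying `s` are assembled into one character of `T X ⊗_B S`, with `X = M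
  -- ⊗_A S*`.
  let Ψ : BTensor B (BTensor A (BTensor B (BTensor A M.carrier (RDual A S)) S) (RDual A S)) S →+
      AddCircle (1 : ℚ) := lift (fun y s => extendCharacter Θ (χ s) y)
    (fun y y' s => map_add _ y y')
    (fun y s s' => by
      rw [← extendCharacter_add]
      congr 2
      ext x
      exact (congrArg ψ (evalAt_add s s' x)).trans (map_add ψ _ _))
    (fun y b s => by
      rw [← extendCharacter_op_smul Θ e h hB]
      congr 2
      ext x
      exact congrArg ψ (evalAt_smul b s x).symm)
  have h1 : ∀ z, Ψ (tensorRight A S (e.coactDual M) z) = 0 := fun z => by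
    induction z using induction_on with
    | zero => simp
    | tmul x s => exact e.extendCharacter_coactDual M Θ (χ s) (hχ s) x
    | add x y hx hy => simp only [map_add, hx, hy, add_zero]
  have h2 : ∀ z, Ψ (tensorRight A S (e.insertElt _) z) = ψ (evalTensor M.carrier z) := fun z => by
    induction z using induction_on with
    | zero => simp
    | tmul x s => exact e.extendCharacter_insertElt Θ hΘ (χ s) x
    | add x y hx hy => simp only [map_add, hx, hy]
  -- Coassociativity exchanges `η ⊗ S`, along which `Ψ` computes `ψ m`, for `d ⊗ S`, along which `Ψ`
  -- is zero.
  rw [← e.evalTensor_coactAssoc M m, ← h2, ← tensorRight_coactDual, h1]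

/-- Each character `χ` of `Hom^D(S, M) ⊗_B S` is shown to come from a character of `M`, namely the
coaction `M → X ⊗_B S` followed by a suitable `Ψ`, with `X = M ⊗_A S*`. -/
theorem evalRight_injective : Function.Injective (e.evalRight M) := by
  have hB := mul_comm_of_totallyFaithfulLeft h hS
  obtain ⟨Θ, hΘ⟩ := e.exists_character_insertElt hS
  refine injective_of_character (e.evalRight M).toAddMonoidHom fun χ => ?_
  -- The choice of `ζ s` is neither unique nor additive in `s`; `h0` shows that the choice does not
  -- matter after extending and restricting along `d`.
  have hζ : ∀ s : S, ∃ ζ : BTensor A M.carrier (RDual A S) →+ AddCircle (1 : ℚ),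
      ∀ φ, ζ (e.homElt M φ) = χ (tmul B φ s) := fun s =>
    exists_character_comp_eq (e.homElt M).toAddMonoidHom
      (AddMonoidHom.mk' (fun φ => χ (tmul B φ s)) fun φ φ' => by rw [add_tmul, map_add])
      fun φ hφ => by
        rw [(injective_iff_map_eq_zero (e.homElt M)).1 (e.homElt_injective M) φ hφ, map_zero]
  choose ζ hζ using hζ
  have h0 : ∀ χ χ' : BTensor A M.carrier (RDual A S) →+ AddCircle (1 : ℚ),
      (∀ φ, χ (e.homElt M φ) = χ' (e.homElt M φ)) → ∀ x,
      extendCharacter Θ χ (e.coactDual M x) = extendCharacter Θ χ' (e.coactDual M x) :=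
    fun χ χ' hχ x => by
      rw [← sub_eq_zero, ← extendCharacter_sub]
      exact e.extendCharacter_coactDual M Θ _ (fun φ => sub_eq_zero.2 (hχ φ)) x
  let Ψ : BTensor B (BTensor A M.carrier (RDual A S)) S →+ AddCircle (1 : ℚ) :=
    lift (fun x s => extendCharacter Θ (ζ s) (e.coactDual M x))
    (fun x x' s => by rw [map_add, map_add])
    (fun x s s' => by
      rw [← extendCharacter_add]
      refine h0 _ _ (fun φ => ?_) x
      rw [AddMonoidHom.add_apply, hζ, hζ, hζ, tmul_add, map_add])
    (fun x b s => by
      rw [map_smul, ← extendCharacter_op_smul Θ e h hB]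
      refine h0 _ _ (fun φ => ?_) x
      rw [hζ, ← smul_tmul, ← hζ, map_smul]
      rfl)
  -- On `φ s` the coaction is `φ(e) ⊗ s`, and `d` agrees with `η` on `φ(e)`, so `Ψ` returns `ζ s
  -- (φ(e)) = χ (φ ⊗ s)`.
  refine ⟨Ψ.comp (e.coactAssoc M).toAddMonoidHom, fun z => ?_⟩
  induction z using induction_on with
  | zero => simp only [map_zero]
  | tmul φ s =>
    refine (congrArg Ψ (e.coactAssoc_homElt M φ s)).trans ?_
    refine (congrArg (extendCharacter Θ (ζ s)) (e.coactDual_homElt M φ)).trans ?_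
    rw [e.extendCharacter_insertElt Θ hΘ, hζ]
  | add x y hx hy => simp only [map_add, hx, hy]

end RightCounit

/-! ## The left hand side -/

section Left

/-- The map `u ⊗ w ↦ (f u) w`. -/
def coevalAt {W : Type u} [AddCommGroup W] [Module A W] (f : RDual A S) : BTensor A S W →+ W :=
  lift (fun u w => f u • w) (fun u u' w => by rw [map_add, add_smul])
    (fun u w w' => smul_add _ w w')
    (fun u a w => by rw [map_smul, op_smul_eq_mul, mul_smul])

@[simp] theorem coevalAt_tmul {W : Type u} [AddCommGroup W] [Module A W] (f : RDual A S) (u : S)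
    (w : W) : coevalAt f (tmul A u w) = f u • w := rfl

theorem coevalAt_add {W : Type u} [AddCommGroup W] [Module A W] (f g : RDual A S)
    (x : BTensor A S W) : coevalAt (f + g) x = coevalAt f x + coevalAt g x := by
  rw [← AddMonoidHom.add_apply]
  exact DFunLike.congr_fun (hom_ext fun u w => by simp [add_smul]) x

theorem coevalAt_smul {W : Type u} [AddCommGroup W] [Module A W] (a : A) (f : RDual A S)
    (x : BTensor A S W) : coevalAt (a • f) x = a • coevalAt f x := by
  induction x using induction_on with
  | zero => simp
  | tmul u w => simp [mul_smul]
  | add x y hx hy => simp only [smul_add, map_add, hx, hy]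

theorem coevalAt_op_smul {W : Type u} [AddCommGroup W] [Module A W] (b : B) (f : RDual A S)
    (x : BTensor A S W) : coevalAt (op b • f) x = coevalAt f (b • x) := by
  induction x using induction_on with
  | zero => simp
  | tmul u w => simp [left_smul_tmul]
  | add x y hx hy => simp only [smul_add, map_add, hx, hy]

/-- The left linear map `S* → W` that corresponds to an element of `S ⊗ W`. -/
def toDualHom {W : Type u} [AddCommGroup W] [Module A W] (x : BTensor A S W) :
    RDual A S →ₗ[A] W where
  toFun f := coevalAt f x
  map_add' f g := coevalAt_add f g x
  map_smul' a f := coevalAt_smul a f x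

theorem toDualHom_apply {W : Type u} [AddCommGroup W] [Module A W] (x : BTensor A S W)
    (f : RDual A S) : toDualHom x f = coevalAt f x := rfl

/-- With `map_toDualHom_elt`, this is the bijection `Hom_A(S*, W) ≅ S ⊗_A W`, again from the dual
basis. -/
theorem coevalAt_map_elt {W : Type u} [AddCommGroup W] [Module A W] (φ : RDual A S →ₗ[A] W)
    (f : RDual A S) : coevalAt f (map LinearMap.id φ e.elt) = φ f := by
  simp only [elt, map_sum, map_tmul, coevalAt_tmul, LinearMap.id_apply, ← map_smul]
  rw [← map_sum, e.sum_smul]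

theorem map_toDualHom_elt {W : Type u} [AddCommGroup W] [Module A W] (x : BTensor A S W) :
    map LinearMap.id (toDualHom x) e.elt = x := by
  simp only [elt, map_sum, map_tmul, LinearMap.id_apply, toDualHom_apply]
  induction x using induction_on with
  | zero => simp [tmul_zero]
  | tmul u w => simp only [coevalAt_tmul, ← smul_tmul, ← sum_tmul, e.sum_eq]
  | add x y hx hy => simp only [map_add, tmul_add, Finset.sum_add_distrib, hx, hy]

theorem map_comp_rmul_elt {W : Type u} [AddCommGroup W] [Module A W] (φ : RDual A S →ₗ[A] W)
    (b : B) : map LinearMap.id (φ.comp (rmul A S (op b))) e.elt =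
      b • map LinearMap.id φ e.elt := by
  have h : map LinearMap.id (rmul A S (op b)) e.elt = b • e.elt := by
    rw [smul_elt]; rfl
  rw [map_id_comp, h]
  exact (mapLeft S B φ).map_smul b e.elt

/-- The map `N → S ⊗_A (S* ⊗_B N)`, `n ↦ e ⊗ n`. -/
def eltInsert (N : Type u) [AddCommGroup N] [Module B N] :
    N →ₗ[B] BTensor A S (BTensor B (RDual A S) N) where
  toFun n := map LinearMap.id (mkLeft B (RDual A S) A n) e.elt
  map_add' n n' := by
    simp only [elt, map_sum, map_tmul, mkLeft_apply, tmul_add, Finset.sum_add_distrib]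
  map_smul' b n := by
    rw [RingHom.id_apply, ← map_comp_rmul_elt]
    congr 2
    exact LinearMap.ext fun f => (smul_tmul f b n).symm

theorem eltInsert_apply {N : Type u} [AddCommGroup N] [Module B N] (n : N) :
    e.eltInsert N n = map LinearMap.id (mkLeft B (RDual A S) A n) e.elt := rfl

theorem coevalAt_eltInsert {N : Type u} [AddCommGroup N] [Module B N] (n : N) (f : RDual A S) :
    coevalAt f (e.eltInsert N n) = tmul B f n :=
  e.coevalAt_map_elt (mkLeft B (RDual A S) A n) f

theorem hom_ext_dual_tensor {N : Type u} {P : Type*} [AddCommGroup N] [Module B N]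
    [AddCommGroup P] {f g : BTensor A S (BTensor B (RDual A S) N) →+ P}
    (h : ∀ u k n, f (tmul A u (tmul B k n)) = g (tmul A u (tmul B k n))) : f = g := by
  refine hom_ext fun u x => ?_
  induction x using induction_on with
  | zero => simp [tmul_zero]
  | tmul k n => exact h u k n
  | add x y hx hy => simp only [tmul_add, map_add, hx, hy]

variable (A S) in
/-- The functor `S ⊗_A (S* ⊗_B -)` on maps. -/
def mapDualTensor {N N' : Type u} [AddCommGroup N] [Module B N] [AddCommGroup N']
    [Module B N'] (g : N →ₗ[B] N') :
    BTensor A S (BTensor B (RDual A S) N) →+ BTensor A S (BTensor B (RDual A S) N') :=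
  map LinearMap.id (tensorLeft A S g)

theorem mapDualTensor_eltInsert {N N' : Type u} [AddCommGroup N] [Module B N]
    [AddCommGroup N'] [Module B N'] (g : N →ₗ[B] N') (n : N) :
    mapDualTensor A S g (e.eltInsert N n) = e.eltInsert N' (g n) := by
  rw [mapDualTensor, eltInsert_apply, ← map_id_comp]
  rfl

/-- Extension of characters along `N → S ⊗_A (S* ⊗_B N)`, for a suitable `Θ`. -/
def coextendCharacter (Θ : BTensor A S (BTensor B (RDual A S) (RingCharacter B)) →+
      AddCircle (1 : ℚ)) {N : Type u} [AddCommGroup N] [Module B N]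
    (χ : N →+ AddCircle (1 : ℚ)) :
    BTensor A S (BTensor B (RDual A S) N) →+ AddCircle (1 : ℚ) :=
  Θ.comp (mapDualTensor A S (RingCharacter.ofLeft χ))

/-! ### Natural extension of characters along `n ↦ e ⊗ n` -/

section CoextendCharacter

variable (Θ : BTensor A S (BTensor B (RDual A S) (RingCharacter B)) →+ AddCircle (1 : ℚ))
  {N N' : Type u} [AddCommGroup N] [Module B N] [AddCommGroup N'] [Module B N']

theorem coextendCharacter_tmul (χ : N →+ AddCircle (1 : ℚ)) (n : N) (u : S) (k : RDual A S) :
    coextendCharacter Θ χ (tmul A u (tmul B k n)) =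
      Θ (tmul A u (tmul B k (RingCharacter.ofLeft χ n))) := rfl

theorem coextendCharacter_add (χ χ' : N →+ AddCircle (1 : ℚ))
    (y : BTensor A S (BTensor B (RDual A S) N)) :
    coextendCharacter Θ (χ + χ') y = coextendCharacter Θ χ y + coextendCharacter Θ χ' y := by
  rw [← AddMonoidHom.add_apply]
  refine DFunLike.congr_fun (hom_ext_dual_tensor (f := coextendCharacter Θ (χ + χ'))
    (g := coextendCharacter Θ χ + coextendCharacter Θ χ') fun u k n => ?_) y
  rw [AddMonoidHom.add_apply]
  simp only [coextendCharacter_tmul]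
  rw [← map_add, ← tmul_add, ← tmul_add]
  rfl

theorem coextendCharacter_sub (χ χ' : N →+ AddCircle (1 : ℚ))
    (y : BTensor A S (BTensor B (RDual A S) N)) :
    coextendCharacter Θ (χ - χ') y = coextendCharacter Θ χ y - coextendCharacter Θ χ' y := by
  rw [eq_sub_iff_add_eq, ← coextendCharacter_add, sub_add_cancel]

theorem coextendCharacter_comp (χ : N' →+ AddCircle (1 : ℚ)) (g : N →ₗ[B] N')
    (y : BTensor A S (BTensor B (RDual A S) N)) :
    coextendCharacter Θ (χ.comp g.toAddMonoidHom) y =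
      coextendCharacter Θ χ (mapDualTensor A S g y) := by
  refine DFunLike.congr_fun (hom_ext_dual_tensor
    (f := coextendCharacter Θ (χ.comp g.toAddMonoidHom))
    (g := (coextendCharacter Θ χ).comp (mapDualTensor A S g)) fun u k n => ?_) y
  have h : RingCharacter.ofLeft (χ.comp g.toAddMonoidHom) n = RingCharacter.ofLeft χ (g n) :=
    RingCharacter.ext fun b => congrArg χ (g.map_smul b n)
  rw [coextendCharacter_tmul, h]
  rfl

theorem coextendCharacter_eltInsert (hΘ : ∀ ξ, Θ (e.eltInsert _ ξ) = ξ 1)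
    (χ : N →+ AddCircle (1 : ℚ)) (n : N) : coextendCharacter Θ χ (e.eltInsert N n) = χ n := by
  rw [coextendCharacter, AddMonoidHom.comp_apply, mapDualTensor_eltInsert, hΘ,
    RingCharacter.ofLeft_apply, one_smul]

/-- `b u ⊗ f = u ⊗ f b` in `S ⊗_A (S* ⊗_B N)`, if `b` commutes with all endomorphisms of `S`. -/
theorem smul_tmul_tmul (e : FiniteDualBasis A S)
    (h : ∀ (φ : S →ₗ[Aᵐᵒᵖ] S) (b : B) (u : S), φ (b • u) = b • φ u)
    (n : N) (u : S) (b : B) (k : RDual A S) :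
    tmul A (b • u) (tmul B k n) = tmul A u (tmul B k (b • n)) := by
  -- As on the right hand side, the rank one endomorphism `v ↦ u k(v)` commutes with `b`.
  have h1 : ∀ v, op (k (b • v)) • u = b • op (k v) • u := fun v =>
    h (toHom (tmul A u k)) b v
  rw [← smul_tmul k b n, ← e.sum_smul (op b • k), sum_tmul, tmul_sum]
  conv_lhs => rw [← e.sum_smul k, sum_tmul, tmul_sum]
  refine Finset.sum_congr rfl fun i _ => ?_
  rw [← left_smul_tmul (k (e.vec i)), ← left_smul_tmul ((op b • k) (e.vec i)), ← smul_tmul,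
    ← smul_tmul, RDual.op_smul_apply, h1, ← smul_comm b]

/-- Commutativity of `B` turns the twist of `χ` into a multiplication on `B⁺`; centrality moves `b`
from `N` to the factor `S`. -/
theorem coextendCharacter_smul (e : FiniteDualBasis A S)
    (h : ∀ (φ : S →ₗ[Aᵐᵒᵖ] S) (b : B) (u : S), φ (b • u) = b • φ u)
    (hB : ∀ b b' : B, b * b' = b' * b)
    (χ : N →+ AddCircle (1 : ℚ)) (b : B) (y : BTensor A S (BTensor B (RDual A S) N)) :
    coextendCharacter Θ (χ.comp (DistribSMul.toAddMonoidHom N b)) y =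
      coextendCharacter Θ χ (b • y) := by
  refine DFunLike.congr_fun (hom_ext_dual_tensor
    (f := coextendCharacter Θ (χ.comp (DistribSMul.toAddMonoidHom N b)))
    (g := (coextendCharacter Θ χ).comp (DistribSMul.toAddMonoidHom _ b)) fun u k n => ?_) y
  have h1 : RingCharacter.ofLeft (χ.comp (DistribSMul.toAddMonoidHom N b)) n =
      b • RingCharacter.ofLeft χ n := RingCharacter.ext fun b' => by
    rw [RingCharacter.smul_apply, hB]
    exact congrArg χ (mul_smul b b' n).symm
  rw [coextendCharacter_tmul, h1, ← smul_tmul_tmul e h]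
  rfl

end CoextendCharacter

theorem exists_character_eltInsert (hS : TotallyFaithfulRight B (RDual A S)) :
    ∃ Θ : BTensor A S (BTensor B (RDual A S) (RingCharacter B)) →+ AddCircle (1 : ℚ),
      ∀ ξ, Θ (e.eltInsert _ ξ) = ξ 1 := by
  refine exists_character_comp_eq (e.eltInsert (RingCharacter B)).toAddMonoidHom
    (AddMonoidHom.mk' (fun ξ : RingCharacter B => ξ 1) fun _ _ => rfl) fun ξ hξ => ?_
  have h0 : ξ = 0 := hS _ ξ fun f => by
    rw [← e.coevalAt_eltInsert, show e.eltInsert _ ξ = 0 from hξ, map_zero]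
  rw [h0]
  rfl

/-! ### Bijectivity of the counit of `(K', R')` -/

section LeftCounit

variable (M : LeftComodule (e.coring B))

/-- The coaction of `M` with values in `S* ⊗_B (S ⊗_A M)`. -/
def leftCoactAssoc : M.carrier →ₗ[A] BTensor B (RDual A S) (BTensor A S M.carrier) :=
  (assocLeft A).comp
    (show M.carrier →ₗ[A] BTensor A (BTensor B (RDual A S) S) M.carrier from M.coact)

theorem leftCoactAssoc_apply (m : M.carrier) : e.leftCoactAssoc M m =
    assoc (show BTensor A (BTensor B (RDual A S) S) M.carrier from M.coact m) := rfl

/-- `S` tensored with the coaction of `M`. -/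
def vecCoact : BTensor A S M.carrier →ₗ[B]
    BTensor A S (BTensor B (RDual A S) (BTensor A S M.carrier)) :=
  mapLeft S B (e.leftCoactAssoc M)

theorem tensorLeft_vecCoact (m : M.carrier) :
    tensorLeft A S (e.vecCoact M) (e.leftCoactAssoc M m) =
      tensorLeft A S (e.eltInsert _) (e.leftCoactAssoc M m) := by
  let J : BTensor A (BTensor B (RDual A S) S) (BTensor A (BTensor B (RDual A S) S) M.carrier) →+
      BTensor B (RDual A S) (BTensor A S (BTensor B (RDual A S) (BTensor A S M.carrier))) :=
    assoc.comp (map LinearMap.id (assocLeft A))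
  let ρ : M.carrier →ₗ[A] BTensor A (BTensor B (RDual A S) S) M.carrier := M.coact
  have h1 : ∀ z : BTensor A (BTensor B (RDual A S) S) M.carrier,
      tensorLeft A S (e.vecCoact M) (assoc z) = J (map LinearMap.id ρ z) := by
    intro z
    induction z using induction_on with
    | zero => simp
    | tmul x m =>
      induction x using induction_on with
      | zero => simp [zero_tmul]
      -- `ρ m` need not be expanded here: the outer `assoc` only takes apart the explicit tensor `f
      -- ⊗ u`.
      | tmul f u => rfl
      | add x y hx hy => simp only [add_tmul, map_add, hx, hy]
    | add x y hx hy => simp only [map_add, hx, hy]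
  have h3 : ∀ z : BTensor A (BTensor B (RDual A S) S) M.carrier,
      tensorLeft A S (e.eltInsert _) (assoc z) =
        J (assoc (map (e.insertRight A B S (RDual A S)) LinearMap.id z)) := by
    intro z
    induction z using induction_on with
    | zero => simp
    | tmul x m =>
      induction x using induction_on with
      | zero => simp [zero_tmul]
      | tmul f u =>
        have h4 : e.insertRight A B S (RDual A S) (tmul B f u) =
          ∑ i, tmul A (tmul B f (e.vec i)) (tmul B (e.covec i) u) := e.insert_tmul f u
        rw [map_tmul, h4, sum_tmul, map_sum, map_sum, assoc_tmul]
        refine Eq.trans (b := tmul B f (e.eltInsert _ (tmul A u m))) rfl ?_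
        rw [eltInsert_apply, elt, map_sum, tmul_sum]
        rfl
      | add x y hx hy => simp only [add_tmul, map_add, hx, hy]
    | add x y hx hy => simp only [map_add, hx, hy]
  rw [leftCoactAssoc_apply, h1, h3]
  exact congrArg J (M.coassoc m).symm

theorem mapDualTensor_vecCoact (x : BTensor A S M.carrier) :
    mapDualTensor A S (e.vecCoact M) (e.vecCoact M x) =
      mapDualTensor A S (e.eltInsert _) (e.vecCoact M x) := by
  induction x using induction_on with
  | zero => simp
  | tmul u m => exact congrArg (tmul A u) (e.tensorLeft_vecCoact M m)
  | add x y hx hy => simp only [map_add, hx, hy]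

/-- The map `Hom^D(S*, M) → S ⊗_A M`, `φ ↦ φ(e)`. -/
def eltHom : LeftComodule.colinear (e.leftComodule B) M →ₗ[B] BTensor A S M.carrier where
  toFun φ := map LinearMap.id (show RDual A S →ₗ[A] M.carrier from φ.1) e.elt
  map_add' φ ψ := by
    rw [elt, map_sum, map_sum, map_sum, ← Finset.sum_add_distrib]
    exact Finset.sum_congr rfl fun i _ => tmul_add _ _ _
  map_smul' b φ := e.map_comp_rmul_elt (show RDual A S →ₗ[A] M.carrier from φ.1) b

theorem eltHom_apply (φ : LeftComodule.colinear (e.leftComodule B) M) :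
    e.eltHom M φ = map LinearMap.id (show RDual A S →ₗ[A] M.carrier from φ.1) e.elt := rfl

theorem leftCoactAssoc_eltHom (φ : LeftComodule.colinear (e.leftComodule B) M) (f : RDual A S) :
    e.leftCoactAssoc M (φ.1 f) = tmul B f (e.eltHom M φ) := by
  have h : e.leftCoactAssoc M (φ.1 f) = assoc (map LinearMap.id
    (show RDual A S →ₗ[A] M.carrier from φ.1) (e.coactCovec B f)) := congrArg assoc (φ.2 f)
  rw [h, eltHom_apply, coactCovec_apply, elt, map_sum, map_sum, map_sum, tmul_sum]
  rfl

/-- The candidate is `toDualHom x`; evaluating the factor `S` of the assumed equation at each `f`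
gives its colinearity. -/
theorem exists_eltHom_eq (x : BTensor A S M.carrier)
    (hx : e.vecCoact M x = e.eltInsert _ x) : ∃ φ, e.eltHom M φ = x := by
  have h1 : ∀ f, e.leftCoactAssoc M (coevalAt f x) = tmul B f x := fun f => by
    rw [← e.coevalAt_eltInsert, ← hx]
    clear hx
    induction x using induction_on with
    | zero => simp
    | tmul u m => exact (e.leftCoactAssoc M).map_smul _ _
    | add x y hx hy => simp only [map_add, hx, hy]
  have h2 : ∀ (m : M.carrier), assocSymm (e.leftCoactAssoc M m) = M.coact m := fun m => by
    have h3 : ∀ z : BTensor A (BTensor B (RDual A S) S) M.carrier, assocSymm (assoc z) = z := by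
      intro z
      induction z using induction_on with
      | zero => simp
      | tmul x m =>
        induction x using induction_on with
        | zero => simp [zero_tmul]
        | tmul f u => rfl
        | add x y hx hy => simp only [add_tmul, map_add, hx, hy]
      | add x y hx hy => simp only [map_add, hx, hy]
    exact h3 _
  have h4 (f : RDual A S) : assocSymm (tmul B f (map LinearMap.id (toDualHom x) e.elt)) =
      map LinearMap.id (toDualHom x) (e.coactCovec B f) := by
    rw [elt, map_sum, tmul_sum, map_sum, coactCovec_apply, map_sum]
    rfl
  simp only [map_toDualHom_elt] at h4
  exact ⟨⟨toDualHom (S := S) x, fun f =>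
    (h2 _).symm.trans ((congrArg assocSymm (h1 f)).trans (h4 f))⟩, e.map_toDualHom_elt x⟩

/-- The map `f ⊗ (u ⊗ m) ↦ (f u) m`. -/
def coevalTensor (W : Type u) [AddCommGroup W] [Module A W] :
    BTensor B (RDual A S) (BTensor A S W) →+ W :=
  lift (fun f x => coevalAt f x) (fun f g x => coevalAt_add f g x) (fun _ x y => map_add _ x y)
    (fun f b x => coevalAt_op_smul b f x)

theorem coevalTensor_leftCoactAssoc (m : M.carrier) :
    coevalTensor M.carrier (e.leftCoactAssoc M m) = m := by
  have h1 : ∀ z : BTensor A (BTensor B (RDual A S) S) M.carrier,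
      coevalTensor M.carrier (assoc z) =
        lid A _ (map (toRightLinear (eval A B S) eval_op_smul) LinearMap.id z) := by
    intro z
    induction z using induction_on with
    | zero => simp
    | tmul x m =>
      induction x using induction_on with
      | zero => simp [zero_tmul]
      | tmul f u => rfl
      | add x y hx hy => simp only [add_tmul, map_add, hx, hy]
    | add x y hx hy => simp only [map_add, hx, hy]
  exact (h1 _).trans (M.counit m)

/-- The same splitting: a character that vanishes on the equalizer factors through the difference of
the two maps, and coassociativity kills the extension. -/
theorem coextendCharacter_vecCoact
    (Θ : BTensor A S (BTensor B (RDual A S) (RingCharacter B)) →+ AddCircle (1 : ℚ))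
    (χ : BTensor A S M.carrier →+ AddCircle (1 : ℚ))
    (hχ : ∀ φ, χ (e.eltHom M φ) = 0) (x : BTensor A S M.carrier) :
    coextendCharacter Θ χ (e.vecCoact M x) = 0 := by
  obtain ⟨ω, hω⟩ := exists_character_comp_eq
    ((e.vecCoact M).toAddMonoidHom - (e.eltInsert _).toAddMonoidHom) χ fun x hx => by
      obtain ⟨φ, rfl⟩ := e.exists_eltHom_eq M x (sub_eq_zero.1 hx)
      exact hχ φ
  have h : χ = ω.comp (e.vecCoact M).toAddMonoidHom - ω.comp (e.eltInsert _).toAddMonoidHom := by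
    ext y
    rw [← hω y]
    exact map_sub ω _ _
  rw [h, coextendCharacter_sub, coextendCharacter_comp, coextendCharacter_comp,
    mapDualTensor_vecCoact, sub_self]

theorem vecCoact_eltHom (φ : LeftComodule.colinear (e.leftComodule B) M) :
    e.vecCoact M (e.eltHom M φ) = e.eltInsert _ (e.eltHom M φ) := by
  refine (map_id_comp (e.leftCoactAssoc M) (show RDual A S →ₗ[A] M.carrier from φ.1)
    e.elt).symm.trans ?_
  have h : (e.leftCoactAssoc M).comp (show RDual A S →ₗ[A] M.carrier from φ.1) =
      mkLeft B (RDual A S) A (e.eltHom M φ) :=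
    LinearMap.ext fun f => e.leftCoactAssoc_eltHom M φ f
  rw [h, eltInsert_apply]

theorem eltHom_injective : Function.Injective (e.eltHom M) := fun φ ψ h =>
  Subtype.ext (LinearMap.ext fun (f : RDual A S) => by
    have h1 := congrArg (coevalAt f) h
    rw [eltHom_apply, eltHom_apply, coevalAt_map_elt, coevalAt_map_elt] at h1
    exact h1)

variable (h : ∀ (φ : S →ₗ[Aᵐᵒᵖ] S) (b : B) (u : S), φ (b • u) = b • φ u)
include h

theorem mul_comm_of_totallyFaithfulRight (hS : TotallyFaithfulRight B (RDual A S)) (b b' : B) :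
    b * b' = b' * b := by
  refine sub_eq_zero.1 (hS B (b * b' - b' * b) fun f => ?_)
  have h0 : op (b * b' - b' * b) • f = 0 := RDual.ext fun u => by
    rw [RDual.op_smul_apply, sub_smul, mul_smul, mul_smul, smul_smul_comm h, sub_self, map_zero,
      RDual.zero_apply]
  have h1 : tmul B f ((b * b' - b' * b) • (1 : B)) = 0 := by rw [← smul_tmul, h0, zero_tmul]
  rwa [smul_eq_mul, mul_one] at h1

variable (hS : TotallyFaithfulRight B (RDual A S))
include hS

/-- For a character `ψ` of `M` that kills the image, the characters `u ⊗ m ↦ ψ(f(u) m)` vanish on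
the equalizer; their extensions, assembled over `f`, recover `ψ` and are zero. -/
theorem evalLeft_surjective : Function.Surjective (e.evalLeft M) := by
  have hB := mul_comm_of_totallyFaithfulRight h hS
  obtain ⟨Θ, hΘ⟩ := e.exists_character_eltInsert hS
  refine surjective_of_character (e.evalLeft M).toAddMonoidHom fun ψ hψ m => ?_
  let χ : RDual A S → BTensor A S M.carrier →+ AddCircle (1 : ℚ) := fun f =>
    ψ.comp (coevalAt f)
  have hχ : ∀ f φ, χ f (e.eltHom M φ) = 0 := fun f φ => by
    rw [eltHom_apply]
    exact (congrArg ψ (e.coevalAt_map_elt _ f)).trans (hψ (tmul B f φ))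
  let Ψ : BTensor B (RDual A S) (BTensor A S (BTensor B (RDual A S) (BTensor A S M.carrier))) →+
      AddCircle (1 : ℚ) := lift (fun f y => coextendCharacter Θ (χ f) y)
    (fun f f' y => by
      rw [← coextendCharacter_add]
      congr 2
      ext x
      exact (congrArg ψ (coevalAt_add f f' x)).trans (map_add ψ _ _))
    (fun f y y' => map_add _ y y')
    (fun f b y => by
      rw [← coextendCharacter_smul Θ e h hB]
      congr 2
      ext x
      exact congrArg ψ (coevalAt_op_smul b f x))
  have h1 : ∀ z, Ψ (tensorLeft A S (e.vecCoact M) z) = 0 := fun z => by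
    induction z using induction_on with
    | zero => simp
    | tmul f x => exact e.coextendCharacter_vecCoact M Θ (χ f) (hχ f) x
    | add x y hx hy => simp only [map_add, hx, hy, add_zero]
  have h2 : ∀ z, Ψ (tensorLeft A S (e.eltInsert _) z) = ψ (coevalTensor M.carrier z) := fun z => by
    induction z using induction_on with
    | zero => simp
    | tmul f x => exact e.coextendCharacter_eltInsert Θ hΘ (χ f) x
    | add x y hx hy => simp only [map_add, hx, hy]
  rw [← e.coevalTensor_leftCoactAssoc M m, ← h2, ← tensorLeft_vecCoact, h1]

theorem evalLeft_injective : Function.Injective (e.evalLeft M) := by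
  have hB := mul_comm_of_totallyFaithfulRight h hS
  obtain ⟨Θ, hΘ⟩ := e.exists_character_eltInsert hS
  refine injective_of_character (e.evalLeft M).toAddMonoidHom fun χ => ?_
  -- Here too `ζ f` is an arbitrary choice, and `h0` removes the dependence on it.
  have hζ : ∀ f : RDual A S, ∃ ζ : BTensor A S M.carrier →+ AddCircle (1 : ℚ),
      ∀ φ, ζ (e.eltHom M φ) = χ (tmul B f φ) := fun f =>
    exists_character_comp_eq (e.eltHom M).toAddMonoidHom
      (AddMonoidHom.mk' (fun φ => χ (tmul B f φ)) fun φ φ' => by rw [tmul_add, map_add])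
      fun φ hφ => by
        rw [(injective_iff_map_eq_zero (e.eltHom M)).1 (e.eltHom_injective M) φ hφ, map_zero]
  choose ζ hζ using hζ
  have h0 : ∀ χ χ' : BTensor A S M.carrier →+ AddCircle (1 : ℚ),
      (∀ φ, χ (e.eltHom M φ) = χ' (e.eltHom M φ)) → ∀ x,
      coextendCharacter Θ χ (e.vecCoact M x) = coextendCharacter Θ χ' (e.vecCoact M x) :=
    fun χ χ' hχ x => by
      rw [← sub_eq_zero, ← coextendCharacter_sub]
      exact e.coextendCharacter_vecCoact M Θ _ (fun φ => sub_eq_zero.2 (hχ φ)) x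
  let Ψ : BTensor B (RDual A S) (BTensor A S M.carrier) →+ AddCircle (1 : ℚ) :=
    lift (fun f x => coextendCharacter Θ (ζ f) (e.vecCoact M x))
    (fun f f' x => by
      rw [← coextendCharacter_add]
      refine h0 _ _ (fun φ => ?_) x
      rw [AddMonoidHom.add_apply, hζ, hζ, hζ, add_tmul, map_add])
    (fun f x x' => by rw [map_add, map_add])
    (fun f b x => by
      rw [map_smul, ← coextendCharacter_smul Θ e h hB]
      refine h0 _ _ (fun φ => ?_) x
      rw [hζ, smul_tmul, ← hζ, map_smul]
      rfl)
  refine ⟨Ψ.comp (e.leftCoactAssoc M).toAddMonoidHom, fun z => ?_⟩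
  induction z using induction_on with
  | zero => simp only [map_zero]
  | tmul f φ =>
    refine (congrArg Ψ (e.leftCoactAssoc_eltHom M φ f)).trans ?_
    refine (congrArg (coextendCharacter Θ (ζ f)) (e.vecCoact_eltHom M φ)).trans ?_
    rw [e.coextendCharacter_eltInsert Θ hΘ, hζ]
  | add x y hx hy => simp only [map_add, hx, hy]

end LeftCounit

end Left

/-! ## Purity and total faithfulness -/

section Purity

theorem map_lLeft_tmul_one {N : Type u} [AddCommGroup N] [Module Bᵐᵒᵖ N] (n : N) :
    map LinearMap.id (e.lLeft (B := B)) (tmul B n 1) = assoc (e.insertElt N n) := by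
  rw [map_tmul, insertElt_apply, elt, map_sum, map_sum]
  refine Eq.trans (b := tmul B n ((1 : B) • e.elt)) rfl ?_
  rw [one_smul, elt, tmul_sum]
  rfl

theorem map_lRight_one_tmul {N : Type u} [AddCommGroup N] [Module B N] (n : N) :
    map (e.lRight (B := B)) LinearMap.id (tmul B 1 n) = assocSymm (e.eltInsert N n) := by
  rw [map_tmul, eltInsert_apply, elt, map_sum, map_sum]
  refine Eq.trans (b := tmul B ((1 : B) • e.elt) n) rfl ?_
  rw [one_smul, elt, sum_tmul]
  rfl

/-- Evaluating `n ⊗ e` at `u` gives `n ⊗ u`; conversely `n ⊗ e` is a sum of terms that contain the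
`n ⊗ eᵢ`. -/
theorem insertElt_eq_zero {N : Type u} [AddCommGroup N] [Module Bᵐᵒᵖ N] {n : N} :
    e.insertElt (B := B) N n = 0 ↔ ∀ u : S, tmul B n u = 0 := by
  refine ⟨fun h u => by rw [← e.evalAt_insertElt, h, map_zero], fun h => ?_⟩
  rw [insertElt_apply, elt, map_sum]
  refine Finset.sum_eq_zero fun i _ => ?_
  rw [map_tmul, mkRight_apply, h, zero_tmul]

theorem eltInsert_eq_zero {N : Type u} [AddCommGroup N] [Module B N] {n : N} :
    e.eltInsert (B := B) N n = 0 ↔ ∀ f : RDual A S, tmul B f n = 0 := by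
  refine ⟨fun h f => by rw [← e.coevalAt_eltInsert, h, map_zero], fun h => ?_⟩
  rw [eltInsert_apply, elt, map_sum]
  refine Finset.sum_eq_zero fun i _ => ?_
  rw [map_tmul, mkLeft_apply, h, tmul_zero]

theorem assocSymm_assoc_insertElt {N : Type u} [AddCommGroup N] [Module Bᵐᵒᵖ N] (n : N) :
    assocSymm (assoc (e.insertElt (B := B) N n)) = e.insertElt N n := by
  rw [insertElt_apply, elt, map_sum, map_sum, map_sum]
  rfl

theorem assoc_assocSymm_eltInsert {N : Type u} [AddCommGroup N] [Module B N] (n : N) :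
    assoc (assocSymm (e.eltInsert (B := B) N n)) = e.eltInsert N n := by
  rw [eltInsert_apply, elt, map_sum, map_sum, map_sum]
  rfl

theorem tmul_rid_one {N : Type u} [AddCommGroup N] [Module Bᵐᵒᵖ N] (x : BTensor B N B) :
    tmul B (rid B N x) 1 = x := by
  induction x using induction_on with
  | zero => rw [map_zero, zero_tmul]
  | tmul n b => rw [rid_tmul, smul_tmul, smul_eq_mul, mul_one]
  | add x y hx hy => rw [map_add, add_tmul, hx, hy]

theorem tmul_one_lid {N : Type u} [AddCommGroup N] [Module B N] (x : BTensor B B N) :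
    tmul B 1 (lid B N x) = x := by
  induction x using induction_on with
  | zero => rw [map_zero, tmul_zero]
  | tmul b n => rw [lid_tmul, ← smul_tmul, op_smul_eq_mul, one_mul]
  | add x y hx hy => rw [map_add, tmul_add, hx, hy]

/-- Under `N ⊗_B B ≅ N` the map `N ⊗ l` is `n ↦ n ⊗ e` up to brackets, and its kernel is computed by
`insertElt_eq_zero`. -/
theorem isPureLeft_iff : IsPureLeft (e.lLeft (B := B)) ↔ TotallyFaithfulLeft B S := by
  constructor
  · intro h N _ _ n hn
    have h1 : tmul B n (1 : B) = 0 := h N <| by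
      rw [map_lLeft_tmul_one, e.insertElt_eq_zero.2 hn, map_zero, map_zero]
    have h2 := congrArg (rid B N) h1
    rwa [rid_tmul, op_one, one_smul, map_zero] at h2
  · intro h N _ _
    refine (injective_iff_map_eq_zero _).2 fun x hx => ?_
    rw [← tmul_rid_one x, map_lLeft_tmul_one] at hx
    have h1 := congrArg assocSymm hx
    rw [assocSymm_assoc_insertElt, map_zero] at h1
    rw [← tmul_rid_one x, h N _ (e.insertElt_eq_zero.1 h1), zero_tmul]

theorem isPureRight_iff :
    IsPureRight (e.lRight (B := B)) ↔ TotallyFaithfulRight B (RDual A S) := by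
  constructor
  · intro h N _ _ n hn
    have h1 : tmul B (1 : B) n = 0 := h N <| by
      rw [map_lRight_one_tmul, e.eltInsert_eq_zero.2 hn, map_zero, map_zero]
    have h2 := congrArg (lid B N) h1
    rwa [lid_tmul, one_smul, map_zero] at h2
  · intro h N _ _
    refine (injective_iff_map_eq_zero _).2 fun x hx => ?_
    rw [← tmul_one_lid x, map_lRight_one_tmul] at hx
    have h1 := congrArg assoc hx
    rw [assoc_assocSymm_eltInsert, map_zero] at h1
    rw [← tmul_one_lid x, h N _ (e.eltInsert_eq_zero.1 h1), tmul_zero]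

/-- Over a commutative ring, a left module is a right module. -/
abbrev rightOfLeft (hB : ∀ b b' : B, b * b' = b' * b) (N : Type*) [AddCommGroup N] [Module B N] :
    Module Bᵐᵒᵖ N :=
  Module.compHom N ((RingHom.id B).fromOpposite fun b b' => hB b b')

/-- Over a commutative ring, a right module is a left module. -/
abbrev leftOfRight (hB : ∀ b b' : B, b * b' = b' * b) (N : Type*) [AddCommGroup N]
    [Module Bᵐᵒᵖ N] : Module B N :=
  Module.compHom N ((RingHom.id B).toOpposite fun b b' => hB b b')

theorem totallyFaithful_iff (e : FiniteDualBasis A S)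
    (h : ∀ (φ : S →ₗ[Aᵐᵒᵖ] S) (b : B) (u : S), φ (b • u) = b • φ u) :
    TotallyFaithfulLeft B S ↔ TotallyFaithfulRight B (RDual A S) := by
  have h1 : ∀ (k : RDual A S) (b : B) (u v : S), op (k (b • v)) • u = b • op (k v) • u :=
    fun k b u v => h (toHom (tmul A u k)) b v
  constructor
  · intro hS N _ _ n hn
    let _ := rightOfLeft (mul_comm_of_totallyFaithfulLeft h hS) N
    have hop : ∀ (b : B) (n : N), op b • n = b • n := fun _ _ => rfl
    refine hS N n fun u => ?_
    -- `T v` sends `k ⊗ n` to `n ⊗ v k(u)`. It is balanced because `v k(b u) = b v k(u)`, and the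
    -- sum over `v = eᵢ`, `k = fᵢ` rebuilds `n ⊗ u`.
    let T (v : S) : BTensor B (RDual A S) N →+ BTensor B N S :=
      lift (fun k n => tmul B n (op (k u) • v))
        (fun k k' n => by rw [RDual.add_apply, MulOpposite.op_add, add_smul, tmul_add])
        (fun k n n' => add_tmul _ _ _)
        (fun k b n => by rw [RDual.op_smul_apply, h1, ← smul_tmul, hop])
    rw [← e.sum_eq u, tmul_sum]
    exact Finset.sum_eq_zero fun i _ =>
      (congrArg (T (e.vec i)) (hn (e.covec i))).trans (map_zero _)
  · intro hS N _ _ n hn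
    let _ := leftOfRight (mul_comm_of_totallyFaithfulRight h hS) N
    have hop : ∀ (b : B) (n : N), b • n = op b • n := fun _ _ => rfl
    refine hS N n fun f => ?_
    -- `T g` sends `n ⊗ u` to `f(u) g ⊗ n`, and the sum over `g = fᵢ`, `u = eᵢ` rebuilds `f ⊗ n`.
    -- Balancedness is `f(b u) g = (f(u) g) b`, obtained by applying `f` to `b u g(v) = u g(b v)`.
    let T (g : RDual A S) : BTensor B N S →+ BTensor B (RDual A S) N :=
      lift (fun n u => tmul B (f u • g) n)
        (fun n n' u => tmul_add _ _ _)
        (fun n u u' => by rw [map_add, add_smul, add_tmul])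
        (fun n b u => by
          rw [← hop, ← smul_tmul]
          congr 1
          ext v
          simp only [RDual.op_smul_apply, RDual.smul_apply]
          have h2 := congrArg f (h1 g b u v)
          rw [smul_comm b] at h2
          exact (map_smul f (op (g (b • v))) u).symm.trans
            (h2.trans (map_smul f (op (g v)) (b • u))))
    rw [← e.sum_smul f, sum_tmul]
    exact Finset.sum_eq_zero fun i _ =>
      (congrArg (T (e.covec i)) (hn (e.vec i))).trans (map_zero _)

end Purity

/-! ## Equivalences -/

section Equivalences

/-- The linear inverse of a bijective colinear map is automatically colinear. -/
theorem isIso_rightComodule {C : Coring A} {M N : RightComodule C} (f : M ⟶ N)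
    (hf : Function.Bijective f.1) : IsIso f := by
  let g : N.carrier →ₗ[Aᵐᵒᵖ] M.carrier := (LinearEquiv.ofBijective f.1 hf).symm
  have hgf : g.comp f.1 = LinearMap.id :=
    LinearMap.ext (LinearEquiv.ofBijective f.1 hf).symm_apply_apply
  have hfg : f.1.comp g = LinearMap.id :=
    LinearMap.ext (LinearEquiv.ofBijective f.1 hf).apply_symm_apply
  refine ⟨⟨g, fun n => ?_⟩, Subtype.ext hgf, Subtype.ext hfg⟩
  rw [← BTensor.map_id (M.coact (g n)), ← hgf, map_comp_id, ← f.2]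
  exact congrArg (fun x => map g LinearMap.id (N.coact x)) (LinearMap.congr_fun hfg n)

theorem isIso_leftComodule {C : Coring A} {M N : LeftComodule C} (f : M ⟶ N)
    (hf : Function.Bijective f.1) : IsIso f := by
  let g : N.carrier →ₗ[A] M.carrier := (LinearEquiv.ofBijective f.1 hf).symm
  have hgf : g.comp f.1 = LinearMap.id :=
    LinearMap.ext (LinearEquiv.ofBijective f.1 hf).symm_apply_apply
  have hfg : f.1.comp g = LinearMap.id :=
    LinearMap.ext (LinearEquiv.ofBijective f.1 hf).apply_symm_apply
  refine ⟨⟨g, fun n => ?_⟩, Subtype.ext hgf, Subtype.ext hfg⟩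
  rw [← BTensor.map_id (M.coact (g n)), ← hgf, map_id_comp, ← f.2]
  exact congrArg (fun x => map LinearMap.id g (N.coact x)) (LinearMap.congr_fun hfg n)

/-- If the left adjoint is faithful on a balanced category and the counit is an isomorphism,
then so is the unit. -/
theorem isInverseEquivalences_of_isIso_counit {X Y : Type*} [Category X] [Category Y]
    [Balanced X] {F : X ⥤ Y} {G : Y ⥤ X} (adj : F ⊣ G) [F.Faithful] [IsIso adj.counit] :
    IsInverseEquivalences adj := by
  refine ⟨?_, inferInstance⟩
  have (x : X) : IsIso (adj.unit.app x) := by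
    have h1 : F.map (adj.unit.app x) ≫ adj.counit.app (F.obj x) = 𝟙 _ :=
      adj.left_triangle_components x
    have h : IsIso (F.map (adj.unit.app x) ≫ adj.counit.app (F.obj x)) := by
      rw [h1]
      infer_instance
    have : IsIso (F.map (adj.unit.app x)) := IsIso.of_isIso_comp_right _ (adj.counit.app (F.obj x))
    -- A faithful functor reflects monomorphisms and epimorphisms, hence isomorphisms when its
    -- source is balanced.
    exact isIso_of_reflects_iso _ F
  exact NatIso.isIso_of_isIso_app _

theorem full_and_faithful {X Y : Type*} [Category X] [Category Y] {F : X ⥤ Y} {G : Y ⥤ X}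
    (adj : F ⊣ G) (h : IsInverseEquivalences adj) : F.Full ∧ F.Faithful :=
  have := h.1
  ⟨adj.fullyFaithfulLOfIsIsoUnit.full, adj.fullyFaithfulLOfIsIsoUnit.faithful⟩

theorem faithful_K_iff : (e.K (B := B)).Faithful ↔ TotallyFaithfulLeft B S := by
  constructor
  · intro _ N _ _ n hn
    -- If `n ⊗ u = 0` for all `u`, then `b ↦ n b` becomes zero after tensoring with `S`, so it is
    -- zero by faithfulness; its value at `1` is `n`.
    let g : ModuleCat.of Bᵐᵒᵖ B ⟶ ModuleCat.of Bᵐᵒᵖ N := ModuleCat.ofHom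
      { toFun := fun b => op b • n
        map_add' := fun b b' => add_smul (op b) (op b') n
        map_smul' := fun b b' => mul_smul b (op b') n }
    have hg : g = 0 := (e.K (B := B)).map_injective <| Subtype.ext <| LinearMap.ext fun x => by
      refine DFunLike.congr_fun (hom_ext (f := map g.hom LinearMap.id)
        (g := map (0 : ModuleCat.of Bᵐᵒᵖ B ⟶ ModuleCat.of Bᵐᵒᵖ N).hom LinearMap.id)
        fun b u => ?_) x
      refine (smul_tmul n b u).trans ((hn _).trans (zero_tmul u).symm)
    have h1 : op (1 : B) • n = 0 := congrArg (fun f => f.hom (1 : B)) hg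
    rwa [op_one, one_smul] at h1
  · intro h
    refine ⟨fun {N N'} g g' hg => ModuleCat.hom_ext (LinearMap.ext fun n => ?_)⟩
    refine sub_eq_zero.1 (h N' _ fun u => ?_)
    have h1 : tmul B (g.hom n) u = tmul B (g'.hom n) u :=
      congrArg (fun f : e.K.obj N ⟶ e.K.obj N' => f.1 (tmul B n u)) hg
    rw [sub_eq_add_neg, add_tmul, neg_tmul, h1, add_neg_cancel]

theorem faithful_K'_iff : (e.K' (B := B)).Faithful ↔ TotallyFaithfulRight B (RDual A S) := by
  constructor
  · intro _ N _ _ n hn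
    let g : ModuleCat.of B B ⟶ ModuleCat.of B N := ModuleCat.ofHom (LinearMap.toSpanSingleton B N n)
    have hg : g = 0 := (e.K' (B := B)).map_injective <| Subtype.ext <| LinearMap.ext fun x => by
      refine DFunLike.congr_fun (hom_ext (f := map LinearMap.id g.hom)
        (g := map LinearMap.id (0 : ModuleCat.of B B ⟶ ModuleCat.of B N).hom)
        fun f b => ?_) x
      refine (smul_tmul f b n).symm.trans ((hn _).trans (tmul_zero f).symm)
    have h1 : (1 : B) • n = 0 := congrArg (fun f => f.hom (1 : B)) hg
    rwa [one_smul] at h1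
  · intro h
    refine ⟨fun {N N'} g g' hg => ModuleCat.hom_ext (LinearMap.ext fun n => ?_)⟩
    refine sub_eq_zero.1 (h N' _ fun f => ?_)
    have h1 : tmul B f (g.hom n) = tmul B f (g'.hom n) :=
      congrArg (fun k : e.K'.obj N ⟶ e.K'.obj N' => k.1 (tmul B f n)) hg
    rw [sub_eq_add_neg, tmul_add, tmul_neg, h1, add_neg_cancel]

variable (h : ∀ (φ : S →ₗ[Aᵐᵒᵖ] S) (b : B) (u : S), φ (b • u) = b • φ u)
include h

theorem isInverseEquivalences_adj (hS : TotallyFaithfulLeft B S) :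
    IsInverseEquivalences (e.adj (B := B)) := by
  have := e.faithful_K_iff.2 hS
  have (M : RightComodule (e.coring B)) : IsIso (e.adj.counit.app M) :=
    isIso_rightComodule _ ⟨e.evalRight_injective M h hS, e.evalRight_surjective M h hS⟩
  have : IsIso (e.adj (B := B)).counit := NatIso.isIso_of_isIso_app _
  exact isInverseEquivalences_of_isIso_counit _

theorem isInverseEquivalences_adj' (hS : TotallyFaithfulRight B (RDual A S)) :
    IsInverseEquivalences (e.adj' (B := B)) := by
  have := e.faithful_K'_iff.2 hS
  have (M : LeftComodule (e.coring B)) : IsIso (e.adj'.counit.app M) :=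
    isIso_leftComodule _ ⟨e.evalLeft_injective M h hS, e.evalLeft_surjective M h hS⟩
  have : IsIso (e.adj' (B := B)).counit := NatIso.isIso_of_isIso_app _
  exact isInverseEquivalences_of_isIso_counit _

end Equivalences

end FiniteDualBasis

end Comatrix

end

/-! ### The equivalence of the eight conditions -/

theorem theorem2p6 {A B S : Type u} [Ring A] [Ring B] [AddCommGroup S] [Module B S]
    [Module Aᵐᵒᵖ S] [SMulCommClass B Aᵐᵒᵖ S] [Module.Finite Aᵐᵒᵖ S] [Module.Projective Aᵐᵒᵖ S]
    (e : Comatrix.FiniteDualBasis A S)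
    (h : ∀ (φ : S →ₗ[Aᵐᵒᵖ] S) (b : B) (u : S), φ (b • u) = b • φ u) :
    List.TFAE [
      Comatrix.IsInverseEquivalences (e.adj (B := B)),
      Comatrix.IsInverseEquivalences (e.adj' (B := B)),
      (e.K (B := B)).Full ∧ (e.K (B := B)).Faithful,
      (e.K' (B := B)).Full ∧ (e.K' (B := B)).Faithful,
      Comatrix.IsPureLeft (e.lLeft (B := B)),
      Comatrix.TotallyFaithfulLeft B S,
      Comatrix.IsPureRight (e.lRight (B := B)),
      Comatrix.TotallyFaithfulRight B (Comatrix.RDual A S)] := by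
  tfae_have 1 → 3 := Comatrix.FiniteDualBasis.full_and_faithful _
  tfae_have 2 → 4 := Comatrix.FiniteDualBasis.full_and_faithful _
  tfae_have 3 → 6 := fun hK => e.faithful_K_iff.1 hK.2
  tfae_have 4 → 8 := fun hK => e.faithful_K'_iff.1 hK.2
  tfae_have 6 → 1 := e.isInverseEquivalences_adj h
  tfae_have 8 → 2 := e.isInverseEquivalences_adj' h
  tfae_have 5 ↔ 6 := e.isPureLeft_iff
  tfae_have 7 ↔ 8 := e.isPureRight_iff
  tfae_have 6 ↔ 8 := Comatrix.FiniteDualBasis.totallyFaithful_iff e h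
  tfae_finish
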